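/- **Model.** Let $n\ge 3$. The ring has $n$ anonymous nodes and $n$ edges, each node being joined to its two neighbours. Three robots are placed on arbitrary nodes (possibly the same). They have pairwise distinct $k$-bit identifiers $b_{k-1}\cdots b_1b_0$; initially each knows only its own identifier. They know nothing about $n$, and each one labels the two directions privately as *left* and *right* (no common chirality; when robots meet they can translate their directions into each other's labels). Time proceeds in synchronous rounds. In a round every robot that has not terminated chooses a direction; then an adversary, knowing everything, removes at most one edge for this round; then every such robot whose chosen edge is present moves along it, and the others stay where they are. Two robots *meet* if they traverse the same edge in opposite directions in the same round (edge crossing detection) or if they are at the same node at the start or after a round; robots that meet exchange their memories. In a round, crossings are processed before meetings at nodes. Robots that have terminated no longer interact. **Algorithm Explore-Dynamic-Ring-3-Robots.** Every robot executes the following. * *Unmarked robots* proceed in phases $i=0,1,2,\dots$, phase $i$ lasting $2^i$ rounds; in phase $i$ a robot tries to move left if $b_{i \bmod k}=0$ and right if $b_{i\bmod k}=1$. When two unmarked robots meet, the one with the larger identifier is marked $A$ and keeps its current direction, the other one is marked $B$ and takes the opposite direction. If three unmarked robots meet at one node, the largest becomes $A$ and the second largest $B$ in this way, and the smallest becomes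 $C$ and takes the direction of $B$. An unmarked robot that meets exactly one of $A$, $B$ becomes $C$ and takes the direction opposite to the one of the robot it met. * *$A$ and $B$* try to move in their fixed directions in every round and count their successful moves since they were marked. * *$C$* tries to move in its direction in every round and counts its successful moves since it last met $A$ or $B$. When it meets $B$ it stores the count as $AtoB$, when it meets $A$ it stores it as $BtoA$, and then it restarts the count from $0$ and takes the direction opposite to the one of the robot it met. (If $C$ was marked in a meeting of all three robots, its count up to its next meeting is not used. No comparison is made before both counts are available.) * *Detection.* If $A$ and $B$ meet again, having made $a$ and $b$ moves, each of them starts the termination procedure with timer $a+b+1$, keeping its direction. If $C$ meets $A$ or $B$ and then $AtoB=BtoA=s$, both start the termination procedure with timer $s+1$, that robot keeping its direction and $C$ taking the opposite one. If the third robot meets $A$ and $B$ together when these meet again, it terminates. * *Termination procedure.* The robot tries to move in its direction in every round, and terminates when its timer, decreased by $1$ per round, reaches $0$, or when it meets another robot. Any robot that meets one that is executing the termination procedure terminates. **Theorem.** For all $n\ge3$ and $k$, all triples of distinct $k$-bit identifiers, all starting nodes, all choices of the robots' private left/right labels and all behaviours of the adversary, the algorithm explores the ring with explicit termination within $7n+n\cdot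 2^k$ rounds (hence in $O(n+n\cdot 2^k)$ rounds): every node is visited by some robot, no robot terminates before all nodes have been visited, and all three robots have terminated after at most $7n+n\cdot 2^k$ rounds. -/

import Mathlib

namespace DynRing

/-! ### The robots: local memory and local computation

Nothing in this part refers to the ring, to its size or to positions. A direction is one of the
two private port labels of the robot that stores it. -/

/-- The two directions, as labelled privately by a robot. -/
inductive Dir
  | left
  | right

/-- The opposite direction. -/
def Dir.opp : Dir → Dir
  | .left => .right
  | .right => .left

/-- The procedure that a robot is executing, with the local variables of that procedure.
A robot executing `explore` has not been marked yet. -/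
inductive Proc
  /-- first stage: round `tstep` (with `0 ≤ tstep < 2 ^ phase`) of phase `phase` -/
  | explore (phase tstep : ℕ)
  /-- the robot is marked `A` and has made `step` successful moves since then -/
  | robotA (step : ℕ)
  /-- the robot is marked `B` and has made `step` successful moves since then -/
  | robotB (step : ℕ)
  /-- the robot is marked `C`; `step` counts the successful moves since it last met `A` or `B`,
  `AtoB` and `BtoA` are the last counts taken from `A` to `B` and from `B` to `A`;
  `none` stands for a count that is not available -/
  | robotC (step AtoB BtoA : Option ℕ)
  /-- the robot knows that the exploration is complete and has `ttime` rounds left -/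
  | startTermination (ttime : ℕ)
  /-- the robot has terminated -/
  | terminated

/-- The memory of a robot: its `k`-bit identifier, the direction it is heading for (in its own
labels) and the procedure being executed. -/
structure Mem (k : ℕ) where
  id : BitVec k
  dir : Dir
  proc : Proc

namespace Mem

variable {k : ℕ}

/-- The direction prescribed by the identifier `b_{k-1} … b_1 b_0` in phase `i`:
`left` if `b_{i mod k} = 0` and `right` if `b_{i mod k} = 1`. -/
def phaseDir (id : BitVec k) (i : ℕ) : Dir :=
  if id.getLsbD (i % k) then .right else .left

/-- The initial memory: the robot knows its own identifier only. -/
def init (id : BitVec k) : Mem k := ⟨id, phaseDir id 0, .explore 0 0⟩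

/-- The robot has terminated. -/
def Halted (m : Mem k) : Prop := m.proc = .terminated

instance (m : Mem k) : Decidable m.Halted :=
  match h : m.proc with
  | .explore _ _ => .isFalse (by simp [Halted, h])
  | .robotA _ => .isFalse (by simp [Halted, h])
  | .robotB _ => .isFalse (by simp [Halted, h])
  | .robotC _ _ _ => .isFalse (by simp [Halted, h])
  | .startTermination _ => .isFalse (by simp [Halted, h])
  | .terminated => .isTrue h

/-- Terminate. -/
def halt (m : Mem k) : Mem k := { m with proc := .terminated }

/-- Local computation at the beginning of a round: choice of the direction of the move. Only an
unmarked robot has something to compute, since all others keep the direction they stored. -/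
def prepare (m : Mem k) : Mem k :=
  match m.proc with
  | .explore i _ => { m with dir := phaseDir m.id i }
  | _ => m

/-- Update of the counters after an attempted move; `moved` tells whether it was successful.
Phase `i` of the first stage consists of `2 ^ i` rounds. -/
def afterMove (moved : Bool) (m : Mem k) : Mem k :=
  match m.proc with
  | .explore i t =>
      { m with proc := if t + 1 < 2 ^ i then .explore i (t + 1) else .explore (i + 1) 0 }
  | .robotA s => { m with proc := .robotA (if moved then s + 1 else s) }
  | .robotB s => { m with proc := .robotB (if moved then s + 1 else s) }
  | .robotC s x y => { m with proc := .robotC (if moved then s.map (· + 1) else s) x y }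
  | .startTermination T => { m with proc := .startTermination (T - 1) }
  | .terminated => m

/-- At the end of a round, a robot whose termination timer is `0` terminates. -/
def expire (m : Mem k) : Mem k :=
  match m.proc with
  | .startTermination 0 => m.halt
  | _ => m

def isA (m : Mem k) : Bool := match m.proc with | .robotA _ => true | _ => false
def isB (m : Mem k) : Bool := match m.proc with | .robotB _ => true | _ => false
def isC (m : Mem k) : Bool := match m.proc with | .robotC _ _ _ => true | _ => false
def isTer (m : Mem k) : Bool := match m.proc with | .startTermination _ => true | _ => false

/-- The number of successful moves stored by a robot marked `A` or `B`. -/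
def getSteps (m : Mem k) : ℕ :=
  match m.proc with
  | .robotA s => s
  | .robotB s => s
  | _ => 0

/-- If a robot marked `C`, meeting `A`, finds that its current count (which becomes `BtoA`) equals
`AtoB`, this common count. -/
def equalAtA (m : Mem k) : Option ℕ :=
  match m.proc with
  | .robotC (some s) (some x) _ => if s = x then some s else none
  | _ => none

/-- If a robot marked `C`, meeting `B`, finds that its current count (which becomes `AtoB`) equals
`BtoA`, this common count. -/
def equalAtB (m : Mem k) : Option ℕ :=
  match m.proc with
  | .robotC (some s) _ (some y) => if s = y then some s else none
  | _ => none

/-- A robot leaves a meeting in the direction opposite to that of the robot `o` it met. -/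
def away (o : Mem k) (m : Mem k) (p : Proc) : Mem k := { m with dir := o.dir.opp, proc := p }

/-- Unmarked robot. If it meets both `A` and `B` then these two have met again, so that the
exploration is complete, and it is told so. If it meets one marked robot it becomes `C` and leaves
in the direction opposite to the one of that robot. If all robots present are unmarked, the one
with the largest identifier becomes `A` and goes on in its direction, the next one becomes `B` and
takes the opposite direction; a third one becomes `C` and leaves in the direction of `B`, where its
first leg, which does not start away from `B`, is not counted. -/
def meetExplore (m : Mem k) (others : List (Mem k)) : Mem k :=
  if others.any isA ∧ others.any isB then m.halt
  else match others.find? (fun o => o.isA || o.isB || o.isC) with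
    | some o => away o m (.robotC (some 0) none none)
    | none =>
      match others.filter (fun o => decide (m.id < o.id)) with
      | [] => { m with proc := .robotA 0 }
      | [a] => away a m (.robotB 0)
      | a :: b :: _ => away (if a.id < b.id then b else a) m (.robotC none none none)

/-- Robot `A`: it starts the termination if it meets `B`, or if it meets `C` and `C` asks for it;
in both cases it keeps its direction. -/
def meetA (m : Mem k) (s : ℕ) (others : List (Mem k)) : Mem k :=
  match others.find? isB with
  | some o => { m with proc := .startTermination (s + o.getSteps + 1) }
  | none =>
    match others.findSome? equalAtA with
    | some c => { m with proc := .startTermination (c + 1) }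
    | none => m

/-- Robot `B`, likewise. -/
def meetB (m : Mem k) (s : ℕ) (others : List (Mem k)) : Mem k :=
  match others.find? isA with
  | some o => { m with proc := .startTermination (s + o.getSteps + 1) }
  | none =>
    match others.findSome? equalAtB with
    | some c => { m with proc := .startTermination (c + 1) }
    | none => m

/-- Robot `C`. If it meets `A` and `B` together it is told that the exploration is complete. If it
meets one of them it records its count, turns round, and either starts the termination (if the
counts in the two directions agree) or starts a new count. -/
def meetC (m : Mem k) (s x y : Option ℕ) (others : List (Mem k)) : Mem k :=
  match others.find? isA, others.find? isB with
  | some _, some _ => m.halt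
  | none, some b =>
      match m.equalAtB with
      | some c => away b m (.startTermination (c + 1))
      | none => away b m (.robotC (some 0) s y)
  | some a, none =>
      match m.equalAtA with
      | some c => away a m (.startTermination (c + 1))
      | none => away a m (.robotC (some 0) x s)
  | none, none => m

/-- Reaction of a robot with memory `m` to a meeting, where `others` are the memories of the robots
it meets. A robot that meets one which is executing the termination procedure, and a robot
executing it that meets any other one, terminates. -/
def meet (m : Mem k) (others : List (Mem k)) : Mem k :=
  match others with
  | [] => m
  | _ :: _ =>
    if others.any isTer then m.halt
    else match m.proc with
      | .explore _ _ => m.meetExplore others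
      | .robotA s => m.meetA s others
      | .robotB s => m.meetB s others
      | .robotC s x y => m.meetC s x y others
      | .startTermination _ => m.halt
      | .terminated => m

/-- The memory of a robot as it is understood by another one it meets: robots that meet translate
directions into each other's labels. `same` tells whether their labels agree. -/
def translate (same : Bool) (m : Mem k) : Mem k :=
  if same then m else { m with dir := m.dir.opp }

end Mem

/-! ### The dynamic ring

The nodes are the elements of `ZMod n`, and the edge `e : ZMod n` joins the nodes `e` and `e + 1`.
There are three robots, numbered by `Fin 3`; the numbers are not known to them. The chirality
`χ r : Bool` of robot `r` tells which of the two ports the robot calls `left`. -/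

/-- Positions and memories of the three robots. -/
structure Config (n k : ℕ) where
  pos : Fin 3 → ZMod n
  mem : Fin 3 → Mem k

variable {n k : ℕ}

/-- Whether a robot of chirality `c` that heads for `d` goes from `p` to `p + 1`
(otherwise it goes from `p` to `p - 1`). -/
def forward (c : Bool) (d : Dir) : Bool :=
  match d with
  | .left => c
  | .right => !c

/-- The node reached from `p`. -/
def target (p : ZMod n) (fwd : Bool) : ZMod n := if fwd then p + 1 else p - 1

/-- The edge used for moving from `p` to `target p fwd`. -/
def edge (p : ZMod n) (fwd : Bool) : ZMod n := if fwd then p else p - 1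

/-- Robots `r ≠ s` with `rel r s` meet: all robots that have not terminated react simultaneously to
the exchanged memories. Robots that have terminated take no part. -/
def exchange (χ : Fin 3 → Bool) (rel : Fin 3 → Fin 3 → Prop) [DecidableRel rel]
    (mem : Fin 3 → Mem k) : Fin 3 → Mem k := fun r =>
  if (mem r).Halted then mem r
  else (mem r).meet
    (((List.finRange 3).filter (fun s => decide (s ≠ r ∧ rel r s ∧ ¬ (mem s).Halted))).map
      (fun s => (mem s).translate (χ r == χ s)))

/-- Meeting of the robots located at the same node. -/
def exchangeAtNodes (χ : Fin 3 → Bool) (pos : Fin 3 → ZMod n) (mem : Fin 3 → Mem k) :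
    Fin 3 → Mem k :=
  exchange χ (fun r s => pos r = pos s) mem

/-- The initial configuration; robots that start at the same node meet there. -/
def initial (χ : Fin 3 → Bool) (id : Fin 3 → BitVec k) (start : Fin 3 → ZMod n) : Config n k :=
  ⟨start, exchangeAtNodes χ start (fun r => Mem.init (id r))⟩

/-- One synchronous round, in which the edge `missing` is absent (no edge, if it is `none`):
the robots choose their directions; each robot that has not terminated moves, if its edge is
present; robots that cross each other on an edge meet; finally robots at the same node meet. -/
def round (χ : Fin 3 → Bool) (missing : Option (ZMod n)) (c : Config n k) : Config n k :=
  let mem₀ : Fin 3 → Mem k := fun r => (c.mem r).prepare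
  let fwd : Fin 3 → Bool := fun r => forward (χ r) (mem₀ r).dir
  let moves : Fin 3 → Bool := fun r =>
    decide (¬ (mem₀ r).Halted ∧ missing ≠ some (edge (c.pos r) (fwd r)))
  let pos' : Fin 3 → ZMod n := fun r => if moves r then target (c.pos r) (fwd r) else c.pos r
  let mem₁ : Fin 3 → Mem k := fun r => (mem₀ r).afterMove (moves r)
  let mem₂ : Fin 3 → Mem k := exchange χ
    (fun r s => moves r = true ∧ moves s = true ∧ fwd r ≠ fwd s ∧
      edge (c.pos r) (fwd r) = edge (c.pos s) (fwd s)) mem₁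
  let mem₃ : Fin 3 → Mem k := exchangeAtNodes χ pos' mem₂
  ⟨pos', fun r => (mem₃ r).expire⟩

/-- The configuration after `t` rounds of the algorithm, where `missing t` is the edge removed by
the adversary in round `t`. -/
def run (χ : Fin 3 → Bool) (id : Fin 3 → BitVec k) (start : Fin 3 → ZMod n)
    (missing : ℕ → Option (ZMod n)) : ℕ → Config n k
  | 0 => initial χ id start
  | t + 1 => round χ (missing t) (run χ id start missing t)

/-- Every node has been visited by a robot within the first `t` rounds. -/
def ExploredBy (e : ℕ → Config n k) (t : ℕ) : Prop :=
  ∀ v : ZMod n, ∃ t' ≤ t, ∃ r : Fin 3, (e t').pos r = v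

/-- Exploration with explicit termination within `T` rounds: no robot terminates before all nodes
have been visited, and all robots have terminated after at most `T` rounds. -/
def ExploresWithExplicitTermination (e : ℕ → Config n k) (T : ℕ) : Prop :=
  (∀ t r, ((e t).mem r).Halted → ExploredBy e t) ∧
  ∃ t ≤ T, ExploredBy e t ∧ ∀ t' ≥ t, ∀ r, ((e t').mem r).Halted

end DynRing

namespace DynRing

/-! ### Memories seen from a common orientation -/

/-! Since at most one edge is missing, two robots that try to use different edges cannot both be
blocked (`Moves.one_le`). Every estimate of progress rests on this.

Two of the three robots share an orientation and their identifiers differ in some bit. In a phase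
that reads this bit, one robot heads against the two others, and its distance to the farther of them
shrinks in every round. If the phase has at least `n` rounds, a meeting occurs in its first `n - 2`
rounds at the latest, and some such phase has length at most `n * 2 ^ k` (`exists_phase`,
`exists_not_exploring`).

From then on `A` and `B` run apart, and the nodes between them form a visited arc. While it has
fewer than `n - 1` edges, `A` and `B` use different edges, so that it grows in every round
(`Gap.step`, `Leg.step`). An arc with `n - 1` edges contains all nodes, and `A` and `B` face each
other across the last edge. Either they cross it and detect completion, or it stays missing; then
`C` moves in every round, and after its current leg it needs at most two more legs of `n - 1` steps
to find equal counts.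

There are no false alarms. `C` catches the robot ahead only in a round in which that robot is
blocked; the robot behind then moves, unless it is blocked on the same edge, in which case the arc
is already full. Hence the way back is longer than the count just taken, except when both are `n -
1`. This is the invariant `Leg.lt_or_eq`.

After a detection the timers are long enough for the other robots to be informed
(`allHaltedBy_of_chase`, `allHaltedBy_of_facing`) and short enough for all to stop within `n + 2`
rounds. The total is at most `(n * 2 ^ k + n) + 4 * (n - 1) + (n + 2)`.

Rounds are computed in integer coordinates on the universal cover, in an orientation common to all
robots (`View`), where they reduce to linear arithmetic. -/

theorem Dir.opp_opp (d : Dir) : d.opp.opp = d := by cases d <;> rfl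

namespace Mem

variable {k : ℕ}

@[simp] theorem translate_true (m : Mem k) : m.translate true = m := rfl

theorem translate_translate (a b : Bool) (m : Mem k) :
    (m.translate a).translate b = m.translate (a == b) := by
  cases a <;> cases b <;> simp [translate, Dir.opp_opp]

@[simp] theorem id_translate (b : Bool) (m : Mem k) : (m.translate b).id = m.id := by
  cases b <;> rfl

@[simp] theorem proc_translate (b : Bool) (m : Mem k) : (m.translate b).proc = m.proc := by
  cases b <;> rfl

@[simp] theorem halted_translate (b : Bool) (m : Mem k) : (m.translate b).Halted ↔ m.Halted := by
  simp [Halted]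

@[simp] theorem isA_translate (b : Bool) (m : Mem k) : (m.translate b).isA = m.isA := by
  simp [isA]

@[simp] theorem isB_translate (b : Bool) (m : Mem k) : (m.translate b).isB = m.isB := by
  simp [isB]

@[simp] theorem isC_translate (b : Bool) (m : Mem k) : (m.translate b).isC = m.isC := by
  simp [isC]

@[simp] theorem isTer_translate (b : Bool) (m : Mem k) : (m.translate b).isTer = m.isTer := by
  simp [isTer]

@[simp] theorem equalAtA_translate (b : Bool) (m : Mem k) :
    (m.translate b).equalAtA = m.equalAtA := by
  simp [equalAtA]

@[simp] theorem equalAtB_translate (b : Bool) (m : Mem k) :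
    (m.translate b).equalAtB = m.equalAtB := by
  simp [equalAtB]

theorem halt_translate (b : Bool) (m : Mem k) : (m.translate b).halt = m.halt.translate b := by
  cases b <;> rfl

theorem away_translate (b : Bool) (o m : Mem k) (p : Proc) :
    away (o.translate b) (m.translate b) p = (away o m p).translate b := by
  cases b <;> simp [away, translate]

theorem afterMove_translate (a b : Bool) (m : Mem k) :
    (m.translate b).afterMove a = (m.afterMove a).translate b := by
  obtain ⟨i, d, p⟩ := m
  cases b <;> cases p <;> rfl

theorem expire_translate (b : Bool) (m : Mem k) :
    (m.translate b).expire = m.expire.translate b := by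
  obtain ⟨i, d, p⟩ := m
  cases b <;> rcases p with _ | _ | _ | _ | (_ | _) | _ <;> rfl

theorem meetExplore_translate (b : Bool) (m : Mem k) (os : List (Mem k)) :
    (m.translate b).meetExplore (os.map (translate b)) = (m.meetExplore os).translate b := by
  simp only [meetExplore, List.any_map, List.find?_map, List.filter_map, Function.comp_def,
    isA_translate, isB_translate, isC_translate, id_translate, halt_translate]
  split
  · rfl
  · cases List.find? (fun x => x.isA || x.isB || x.isC) os with
    | some o => simp [away_translate]
    | none =>
      simp only [Option.map_none]
      generalize List.filter (fun x => decide (m.id < x.id)) os = l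
      rcases l with _ | ⟨o, _ | ⟨o', l⟩⟩
      · cases b <;> rfl
      · simp [away_translate]
      · simp only [List.map_cons, id_translate, ← away_translate]
        split <;> rfl

theorem meetA_translate (b : Bool) (m : Mem k) (s : ℕ) (os : List (Mem k)) :
    (m.translate b).meetA s (os.map (translate b)) = (m.meetA s os).translate b := by
  simp only [meetA, List.find?_map, List.findSome?_map, Function.comp_def,
    isB_translate, equalAtA_translate]
  cases List.find? (fun x => x.isB) os with
  | some o => cases b <;> rfl
  | none =>
    cases List.findSome? (fun x => x.equalAtA) os <;> cases b <;> rfl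

theorem meetB_translate (b : Bool) (m : Mem k) (s : ℕ) (os : List (Mem k)) :
    (m.translate b).meetB s (os.map (translate b)) = (m.meetB s os).translate b := by
  simp only [meetB, List.find?_map, List.findSome?_map, Function.comp_def,
    isA_translate, equalAtB_translate]
  cases List.find? (fun x => x.isA) os with
  | some o => cases b <;> rfl
  | none =>
    cases List.findSome? (fun x => x.equalAtB) os <;> cases b <;> rfl

theorem meetC_translate (b : Bool) (m : Mem k) (s x y : Option ℕ) (os : List (Mem k)) :
    (m.translate b).meetC s x y (os.map (translate b)) = (m.meetC s x y os).translate b := by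
  simp only [meetC, List.find?_map, Function.comp_def, isA_translate, isB_translate,
    equalAtA_translate, equalAtB_translate]
  cases List.find? (fun x => x.isA) os <;> cases List.find? (fun x => x.isB) os
  · rfl
  · cases m.equalAtB <;> simp [away_translate]
  · cases m.equalAtA <;> simp [away_translate]
  · simp [halt_translate]

/-- A meeting compares identifiers, marks and counters, and only copies or reverses directions; so
it commutes with a change of labels. -/
theorem meet_translate (b : Bool) (m : Mem k) (os : List (Mem k)) :
    (m.translate b).meet (os.map (translate b)) = (m.meet os).translate b := by
  rcases os with _ | ⟨o, os⟩
  · rfl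
  · simp only [meet.eq_def, List.map_cons]
    simp only [← List.map_cons, List.any_map, Function.comp_def, isTer_translate, proc_translate]
    split
    · exact halt_translate b m
    · cases m.proc
      · exact meetExplore_translate b m _
      · exact meetA_translate b m _ _
      · exact meetB_translate b m _ _
      · exact meetC_translate b m _ _ _ _
      · exact halt_translate b m
      · rfl

end Mem

variable {n k : ℕ}

open Classical in
/-- `exchange` for robots that all have the same orientation. -/
noncomputable def exch (rel : Fin 3 → Fin 3 → Prop) (m : Fin 3 → Mem k) : Fin 3 → Mem k :=
  exchange (fun _ => true) rel m

/-- A robot reads the others in its own labels. Passing on to the orientation `β` cancels its own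
chirality, so all memories can be read in one orientation. -/
theorem translate_exchange (χ : Fin 3 → Bool) (β : Bool) (rel rel' : Fin 3 → Fin 3 → Prop)
    [DecidableRel rel] (hrel : ∀ r s, rel r s ↔ rel' r s) (mem : Fin 3 → Mem k) (r : Fin 3) :
    (exchange χ rel mem r).translate (χ r == β) =
      exch rel' (fun r => (mem r).translate (χ r == β)) r := by
  obtain rfl : rel = rel' := by ext r s; exact hrel r s
  simp only [exch, exchange, Mem.halted_translate]
  split
  · rfl
  · rw [← Mem.meet_translate, List.map_map]
    congr 1
    simp only [beq_self_eq_true, Mem.translate_true]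
    congr 1
    · funext s
      simp only [Function.comp_apply, Mem.translate_translate]
      congr 1
      cases χ r <;> cases χ s <;> cases β <;> rfl

/-- Three different robots. -/
structure Tri (a b c : Fin 3) : Prop where
  ab : a ≠ b
  ac : a ≠ c
  bc : b ≠ c

namespace Tri

variable {a b c : Fin 3}

theorem swap (h : Tri a b c) : Tri b a c := ⟨h.ab.symm, h.bc, h.ac⟩

theorem rotate (h : Tri a b c) : Tri b c a := ⟨h.bc, h.ab.symm, h.ac.symm⟩

theorem rev (h : Tri a b c) : Tri c b a := ⟨h.bc.symm, h.ac.symm, h.ab.symm⟩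

theorem cases (h : Tri a b c) (r : Fin 3) : r = a ∨ r = b ∨ r = c := by
  obtain ⟨h1, h2, h3⟩ := h
  omega

end Tri

theorem exch_eq_meet {rel : Fin 3 → Fin 3 → Prop} {m : Fin 3 → Mem k} {r : Fin 3}
    (hr : ¬ (m r).Halted) (p : Fin 3 → Bool)
    (hp : ∀ s, p s = true ↔ s ≠ r ∧ rel r s ∧ ¬ (m s).Halted) :
    exch rel m r = (m r).meet (((List.finRange 3).filter p).map m) := by
  classical
  simp only [exch, exchange, if_neg hr, beq_self_eq_true, Mem.translate_true]
  congr
  funext s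
  rw [Bool.eq_iff_iff, hp]
  exact decide_eq_true_iff

theorem exch_self {rel : Fin 3 → Fin 3 → Prop} {m : Fin 3 → Mem k} {r : Fin 3}
    (h : ∀ s, s ≠ r → rel r s → (m s).Halted) : exch rel m r = m r := by
  by_cases hr : (m r).Halted
  · simp [exch, exchange, hr]
  · rw [exch_eq_meet hr (fun _ => false) (by simpa using h), List.filter_eq_nil_iff.2 (by simp)]
    rfl

theorem exch_pair {rel : Fin 3 → Fin 3 → Prop} {m : Fin 3 → Mem k} {a b c : Fin 3}
    (ht : Tri a b c) (hab : rel a b) (ha : ¬ (m a).Halted) (hb : ¬ (m b).Halted)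
    (hc : rel a c → (m c).Halted) : exch rel m a = (m a).meet [m b] := by
  rw [exch_eq_meet ha (fun s => decide (s = b))]
  · have : (List.finRange 3).filter (fun s => decide (s = b)) = [b] := by
      clear * -
      decide +revert
    rw [this, List.map_singleton]
  · intro s
    rcases ht.cases s with rfl | rfl | rfl
    · simp [ht.ab]
    · simp [ht.ab.symm, hab, hb]
    · simpa [ht.bc.symm] using fun _ => hc

/-- The order in which the other two robots are listed depends on their numbers, which `Tri` leaves
open; hence the disjunction. -/
theorem exch_triple {rel : Fin 3 → Fin 3 → Prop} {m : Fin 3 → Mem k} {a b c : Fin 3}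
    (ht : Tri a b c) (hab : rel a b) (hac : rel a c) (ha : ¬ (m a).Halted) (hb : ¬ (m b).Halted)
    (hc : ¬ (m c).Halted) :
    exch rel m a = (m a).meet [m b, m c] ∨ exch rel m a = (m a).meet [m c, m b] := by
  have h : (List.finRange 3).filter (fun s => decide (s ≠ a)) = [b, c] ∨
      (List.finRange 3).filter (fun s => decide (s ≠ a)) = [c, b] := by
    obtain ⟨h1, h2, h3⟩ := ht
    clear * - h1 h2 h3
    decide +revert
  rw [exch_eq_meet ha (fun s => decide (s ≠ a))]
  · rcases h with h | h <;> rw [h] <;> simp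
  · intro s
    rcases ht.cases s with rfl | rfl | rfl <;> simp [*]

/-! ### One round in lifted coordinates -/

/-- The sign of a direction. -/
def sg : Dir → ℤ
  | .left => 1
  | .right => -1

/-- The sign of an orientation. -/
def ori : Bool → ℤ
  | true => 1
  | false => -1

theorem ori_not (β : Bool) : ori (!β) = -ori β := by cases β <;> rfl

theorem sg_opp (d : Dir) : sg d.opp = -sg d := by cases d <;> rfl

theorem ori_mul_cast_eq_iff (β : Bool) (u v : ℤ) :
    ((ori β * u : ℤ) : ZMod n) = ((ori β * v : ℤ) : ZMod n) ↔ (n : ℤ) ∣ u - v := by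
  rw [← sub_eq_zero, ← Int.cast_sub, ZMod.intCast_zmod_eq_zero_iff_dvd, ← mul_sub]
  cases β <;> simp [ori, dvd_sub_comm]

/-- In coordinates `u` of the universal cover, oriented like the label `left` of the chirality `β`,
the positions are `u` and the memories are `m`. -/
structure View (χ : Fin 3 → Bool) (β : Bool) (c : Config n k) (u : Fin 3 → ℤ)
    (m : Fin 3 → Mem k) : Prop where
  pos : ∀ r, c.pos r = ((ori β * u r : ℤ) : ZMod n)
  mem : ∀ r, (c.mem r).translate (χ r == β) = m r

/-- Reflection of the universal cover. It allows a chosen robot to be assumed to head for `left`,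
the direction of increasing coordinates. -/
theorem View.flip {χ : Fin 3 → Bool} {β : Bool} {c : Config n k} {u : Fin 3 → ℤ}
    {m : Fin 3 → Mem k} (h : View χ β c u m) :
    View χ (!β) c (fun r => -u r) (fun r => (m r).translate false) := by
  refine ⟨fun r => ?_, fun r => ?_⟩
  · rw [h.pos, ori_not, neg_mul_neg]
  · rw [← h.mem, Mem.translate_translate]
    cases χ r <;> cases β <;> rfl

theorem View.halted_iff {χ : Fin 3 → Bool} {β : Bool} {c : Config n k} {u : Fin 3 → ℤ}
    {m : Fin 3 → Mem k} (h : View χ β c u m) (r : Fin 3) :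
    (c.mem r).Halted ↔ (m r).Halted := by
  rw [← h.mem, Mem.halted_translate]

theorem View.pos_eq_iff {χ : Fin 3 → Bool} {β : Bool} {c : Config n k} {u : Fin 3 → ℤ}
    {m : Fin 3 → Mem k} (h : View χ β c u m) (r s : Fin 3) :
    c.pos r = c.pos s ↔ (n : ℤ) ∣ u r - u s := by
  rw [h.pos, h.pos, ori_mul_cast_eq_iff]

/-- The robots at `u` and `v` that head for `d` and `d'` use the same edge. -/
def SameEdge (n : ℕ) (u : ℤ) (d : Dir) (v : ℤ) (d' : Dir) : Prop :=
  d' = d ∧ (n : ℤ) ∣ u - v ∨ d' = d.opp ∧ (n : ℤ) ∣ u + sg d - v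

theorem edge_eq_iff (β : Bool) (u v : ℤ) (d d' : Dir) :
    edge ((ori β * u : ℤ) : ZMod n) (forward β d) = edge ((ori β * v : ℤ) : ZMod n) (forward β d') ↔
      SameEdge n u d v d' := by
  have h1 : ∀ d u, edge ((ori β * u : ℤ) : ZMod n) (forward β d) =
      ((ori β * (if forward β d then u else u - ori β) : ℤ) : ZMod n) := by
    intro d u
    cases β <;> cases d <;> simp [edge, forward, ori] <;> ring
  rw [h1, h1, ori_mul_cast_eq_iff, SameEdge]
  cases β <;> cases d <;> cases d' <;> simp [forward, ori, Dir.opp, sg] <;> ring_nf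

theorem target_eq (β : Bool) (u : ℤ) (d : Dir) :
    target ((ori β * u : ℤ) : ZMod n) (forward β d) = ((ori β * (u + sg d) : ℤ) : ZMod n) := by
  cases β <;> cases d <;> simp [target, forward, ori, sg] <;> ring

theorem forward_translate (a β : Bool) (m : Mem k) :
    forward β (m.translate (a == β)).dir = forward a m.dir := by
  cases a <;> cases β <;> cases hd : m.dir <;> simp [Mem.translate, hd, forward, Dir.opp]

/-- The local computation at the beginning of a round, in the orientation `β`. -/
def prep (χ : Fin 3 → Bool) (β : Bool) (m : Fin 3 → Mem k) : Fin 3 → Mem k := fun r =>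
  ((m r).translate (χ r == β)).prepare.translate (χ r == β)

/-- `mv` tells which robots may move in a round, where at most one edge is missing. -/
structure Moves (n : ℕ) (u : Fin 3 → ℤ) (m : Fin 3 → Mem k) (mv : Fin 3 → Bool) : Prop where
  halted : ∀ r, (m r).Halted → mv r = false
  blocked : ∀ r s, ¬ (m r).Halted → ¬ (m s).Halted → mv r = false → mv s = false →
    SameEdge n (u r) (m r).dir (u s) (m s).dir
  same : ∀ r s, ¬ (m r).Halted → ¬ (m s).Halted →
    SameEdge n (u r) (m r).dir (u s) (m s).dir → mv r = mv s

/-- The coordinates after a round. -/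
def move (u : Fin 3 → ℤ) (m : Fin 3 → Mem k) (mv : Fin 3 → Bool) : Fin 3 → ℤ := fun r =>
  u r + if mv r then sg (m r).dir else 0

/-- The robots `r` and `s` cross each other. -/
def Cross (n : ℕ) (u : Fin 3 → ℤ) (m : Fin 3 → Mem k) (mv : Fin 3 → Bool) (r s : Fin 3) : Prop :=
  mv r = true ∧ mv s = true ∧ (m s).dir = (m r).dir.opp ∧ (n : ℤ) ∣ u r + sg (m r).dir - u s

/-- The robots `r` and `s` are at the same node. -/
def Node (n : ℕ) (u : Fin 3 → ℤ) (r s : Fin 3) : Prop := (n : ℤ) ∣ u r - u s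

/-- The memories after the crossings of a round. -/
noncomputable def crossed (n : ℕ) (u : Fin 3 → ℤ) (m : Fin 3 → Mem k) (mv : Fin 3 → Bool) :
    Fin 3 → Mem k :=
  exch (Cross n u m mv) (fun r => (m r).afterMove (mv r))

/-- The memories after a round. -/
noncomputable def result (n : ℕ) (u : Fin 3 → ℤ) (m : Fin 3 → Mem k) (mv : Fin 3 → Bool) :
    Fin 3 → Mem k := fun r =>
  (exch (Node n (move u m mv)) (crossed n u m mv) r).expire

/-- The adversary is eliminated here: of the missing edge only the consequences listed in `Moves`
are kept. -/
theorem View.round {χ : Fin 3 → Bool} {β : Bool} {c : Config n k} {u : Fin 3 → ℤ}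
    {m : Fin 3 → Mem k} (h : View χ β c u m) (missing : Option (ZMod n)) :
    ∃ mv, Moves n u (prep χ β m) mv ∧
      View χ β (round χ missing c) (move u (prep χ β m) mv) (result n u (prep χ β m) mv) := by
  have hprep : ∀ r, (c.mem r).prepare.translate (χ r == β) = prep χ β m r := by
    intro r
    rw [prep, ← h.mem r, Mem.translate_translate]
    simp
  have hfwd : ∀ r, forward (χ r) (c.mem r).prepare.dir = forward β (prep χ β m r).dir := by
    intro r
    rw [← hprep, forward_translate]
  have hhalt : ∀ r, (c.mem r).prepare.Halted ↔ (prep χ β m r).Halted := by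
    intro r
    rw [← hprep, Mem.halted_translate]
  have hedge : ∀ r s, edge (c.pos r) (forward (χ r) (c.mem r).prepare.dir) =
      edge (c.pos s) (forward (χ s) (c.mem s).prepare.dir) ↔
      SameEdge n (u r) (prep χ β m r).dir (u s) (prep χ β m s).dir := by
    intro r s
    rw [h.pos, h.pos, hfwd, hfwd, edge_eq_iff]
  set mv : Fin 3 → Bool := fun r => decide (¬ ((c.mem r).prepare).Halted ∧
    missing ≠ some (edge (c.pos r) (forward (χ r) (c.mem r).prepare.dir))) with hmv
  have hpos : ∀ r, (DynRing.round χ missing c).pos r =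
      ((ori β * move u (prep χ β m) mv r : ℤ) : ZMod n) := by
    intro r
    change (if mv r then target (c.pos r) (forward (χ r) (c.mem r).prepare.dir) else c.pos r) = _
    rw [h.pos, hfwd, target_eq, move]
    split <;> simp
  refine ⟨mv, ⟨fun r hr => ?_, fun r s hr hs h1 h2 => ?_, fun r s hr hs hrs => ?_⟩,
    hpos, fun r => ?_⟩
  · simp [hmv, hhalt, hr]
  · rw [← hedge]
    simp only [hmv, hhalt, hr, hs, not_false_eq_true, true_and, decide_eq_false_iff_not,
      not_not, ne_eq] at h1 h2
    rw [h1] at h2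
    exact Option.some.inj h2
  · rw [← hedge] at hrs
    simp only [hmv, hhalt, hr, hs, hrs]
  · simp only [DynRing.round, exchangeAtNodes, result, ← Mem.expire_translate]
    congr 1
    refine (translate_exchange χ β _ (Node n (move u (prep χ β m) mv)) ?_ _ r).trans ?_
    rotate_left
    · congr 1
      funext s
      refine (translate_exchange χ β _ (Cross n u (prep χ β m) mv) ?_ _ s).trans ?_
      rotate_left
      · rw [crossed]
        congr 1
        funext q
        rw [← Mem.afterMove_translate, hprep]
      · intro r s
        change (mv r = true ∧ mv s = true ∧ _) ↔ _
        rw [hedge, hfwd, hfwd, Cross, SameEdge]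
        cases (prep χ β m r).dir <;> cases (prep χ β m s).dir <;> cases β <;>
          simp [forward, Dir.opp]
    · intro r s
      change ((DynRing.round χ missing c).pos r = (DynRing.round χ missing c).pos s) ↔ _
      rw [hpos, hpos, ori_mul_cast_eq_iff]
      rfl

theorem View.exists (χ : Fin 3 → Bool) (β : Bool) (c : Config n k) :
    ∃ u m, View χ β c u m := by
  have : ∀ p : ZMod n, ∃ v : ℤ, p = ((ori β * v : ℤ) : ZMod n) := by
    intro p
    obtain ⟨v, rfl⟩ := ZMod.intCast_surjective p
    refine ⟨ori β * v, ?_⟩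
    cases β <;> simp [ori]
  choose f hf using this
  exact ⟨fun r => f (c.pos r), _, fun r => hf _, fun r => rfl⟩

/-- `prepare` is the one local step that does not commute with `translate`, because `phaseDir`
refers to private labels. For marked robots it is trivial. -/
theorem prep_of_not_explore (χ : Fin 3 → Bool) (β : Bool) (m : Fin 3 → Mem k) (r : Fin 3)
    (h : ∀ i t, (m r).proc ≠ .explore i t) : prep χ β m r = m r := by
  have : ((m r).translate (χ r == β)).prepare = (m r).translate (χ r == β) := by
    rw [Mem.prepare]
    split
    · rename_i i t hp
      rw [Mem.proc_translate] at hp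
      exact absurd hp (h i t)
    · rfl
  rw [prep, this, Mem.translate_translate]
  simp

end DynRing

namespace DynRing

/-! ### Encounters of two robots -/

/-- The procedure of a robot marked `A` (if `b`) or `B`. -/
def mark (b : Bool) (s : ℕ) : Proc := if b then .robotA s else .robotB s

/-- The procedure of a robot marked `C`, where `v` is the last count taken while heading for the
robot with mark `b` that is not older than the count `w` for the other direction. -/
def cproc (b : Bool) (s v w : Option ℕ) : Proc := if b then .robotC s v w else .robotC s w v

/-- The common value of two available and equal counts. -/
def agree : Option ℕ → Option ℕ → Option ℕ
  | some s, some v => if s = v then some s else none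
  | _, _ => none

theorem agree_none_right (s : Option ℕ) : agree s none = none := by
  cases s <;> rfl

namespace Mem

variable {k : ℕ} (i i' : BitVec k) (d d' : Dir) (b : Bool)

@[simp] theorem not_halted_mark (s : ℕ) : ¬ (⟨i, d, mark b s⟩ : Mem k).Halted := by
  cases b <;> simp [Halted, mark]

@[simp] theorem not_halted_cproc (s v w : Option ℕ) : ¬ (⟨i, d, cproc b s v w⟩ : Mem k).Halted := by
  cases b <;> simp [Halted, cproc]

@[simp] theorem not_halted_explore (p t : ℕ) : ¬ (⟨i, d, .explore p t⟩ : Mem k).Halted := by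
  simp [Halted]

@[simp] theorem not_halted_term (T : ℕ) : ¬ (⟨i, d, .startTermination T⟩ : Mem k).Halted := by
  simp [Halted]

@[simp] theorem afterMove_mark (x : Bool) (s : ℕ) :
    (⟨i, d, mark b s⟩ : Mem k).afterMove x = ⟨i, d, mark b (s + x.toNat)⟩ := by
  cases b <;> cases x <;> rfl

@[simp] theorem afterMove_cproc (x : Bool) (s v w : Option ℕ) :
    (⟨i, d, cproc b s v w⟩ : Mem k).afterMove x =
      ⟨i, d, cproc b (s.map (· + x.toNat)) v w⟩ := by
  cases b <;> cases x <;> simp [afterMove, cproc]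

@[simp] theorem afterMove_term (x : Bool) (T : ℕ) :
    (⟨i, d, .startTermination T⟩ : Mem k).afterMove x = ⟨i, d, .startTermination (T - 1)⟩ := rfl

theorem afterMove_explore (x : Bool) (p t : ℕ) :
    (⟨i, d, .explore p t⟩ : Mem k).afterMove x =
      ⟨i, d, if t + 1 < 2 ^ p then .explore p (t + 1) else .explore (p + 1) 0⟩ := rfl

@[simp] theorem expire_mark (s : ℕ) :
    (⟨i, d, mark b s⟩ : Mem k).expire = ⟨i, d, mark b s⟩ := by
  cases b <;> rfl

@[simp] theorem expire_cproc (s v w : Option ℕ) :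
    (⟨i, d, cproc b s v w⟩ : Mem k).expire = ⟨i, d, cproc b s v w⟩ := by
  cases b <;> rfl

@[simp] theorem expire_explore (p t : ℕ) :
    (⟨i, d, .explore p t⟩ : Mem k).expire = ⟨i, d, .explore p t⟩ := rfl

@[simp] theorem expire_term_succ (T : ℕ) :
    (⟨i, d, .startTermination (T + 1)⟩ : Mem k).expire = ⟨i, d, .startTermination (T + 1)⟩ := rfl

theorem expire_term {T : ℕ} (h : 1 ≤ T) :
    (⟨i, d, .startTermination T⟩ : Mem k).expire = ⟨i, d, .startTermination T⟩ := by
  obtain ⟨T, rfl⟩ := Nat.exists_eq_add_of_le' h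
  rfl

@[simp] theorem halted_halt (m : Mem k) : m.halt.Halted := rfl

theorem Halted.expire {m : Mem k} (h : m.Halted) : m.expire.Halted := by
  obtain ⟨i, d, p⟩ := m
  cases h
  rfl

theorem halted_afterMove (x : Bool) (m : Mem k) : (m.afterMove x).Halted ↔ m.Halted := by
  obtain ⟨i, d, p⟩ := m
  cases p
  · simp only [afterMove, Halted]
    split <;> simp
  all_goals simp [afterMove, Halted]

theorem meet_mark_mark (s s' : ℕ) :
    (⟨i, d, mark b s⟩ : Mem k).meet [⟨i', d', mark (!b) s'⟩] =
      ⟨i, d, .startTermination (s + s' + 1)⟩ := by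
  cases b <;>
    simp [meet.eq_def, mark, meetA, meetB, isTer, isA, isB, getSteps]

theorem meet_mark_explore (s p t : ℕ) :
    (⟨i, d, mark b s⟩ : Mem k).meet [⟨i', d', .explore p t⟩] = ⟨i, d, mark b s⟩ := by
  cases b <;>
    simp [meet.eq_def, mark, meetA, meetB, isTer, isA, isB, equalAtA, equalAtB]

theorem meet_explore_mark (s p t : ℕ) :
    (⟨i, d, .explore p t⟩ : Mem k).meet [⟨i', d', mark b s⟩] =
      ⟨i, d'.opp, cproc (!b) (some 0) none none⟩ := by
  cases b <;>
    simp [meet.eq_def, mark, meetExplore, isTer, isA, isB, isC, cproc, away]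

theorem meet_mark_cproc (j : ℕ) (s v w : Option ℕ) :
    (⟨i, d, mark b j⟩ : Mem k).meet [⟨i', d', cproc b s v w⟩] =
      ⟨i, d, (agree s v).elim (mark b j) (fun c => .startTermination (c + 1))⟩ := by
  cases b <;> cases s <;> cases v <;>
    simp [meet.eq_def, mark, meetA, meetB, isTer, isA, isB, equalAtA, equalAtB, cproc, agree] <;>
    split <;> simp_all

/-- The count `s` of the leg that ends is compared with the count `v` of the leg before. Without
agreement, `s` becomes the count to compare with on the way back to the robot marked `!b`. -/
theorem meet_cproc_mark (j : ℕ) (s v w : Option ℕ) :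
    (⟨i, d, cproc b s v w⟩ : Mem k).meet [⟨i', d', mark b j⟩] =
      ⟨i, d'.opp, (agree s v).elim (cproc (!b) (some 0) s v)
        (fun c => .startTermination (c + 1))⟩ := by
  cases b <;> cases s <;> cases v <;>
    simp [meet.eq_def, mark, meetC, isTer, isA, isB, equalAtA, equalAtB, cproc, agree, away] <;>
    split <;> simp_all

theorem halted_meet_term (m : Mem k) (T : ℕ) :
    (m.meet [⟨i', d', .startTermination T⟩]).Halted := by
  simp [meet.eq_def, isTer]

theorem halted_term_meet (m : Mem k) (T : ℕ) :
    ((⟨i, d, .startTermination T⟩ : Mem k).meet [m]).Halted := by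
  simp only [meet.eq_def]
  split <;> exact halted_halt _

end Mem

/-! ### Computing a round -/

variable {n k : ℕ} {u : Fin 3 → ℤ} {m : Fin 3 → Mem k} {mv : Fin 3 → Bool} {r s a b c : Fin 3}

/-- The coordinate differences to be tested stay within two turns, so each coincidence modulo `n`
splits into three linear cases for `omega`. -/
theorem dvd_cases {w : ℤ} (h : (n : ℤ) ∣ w) (h1 : -(2 * n) < w) (h2 : w < 2 * n) :
    w = 0 ∨ w = n ∨ w = -n := by
  obtain ⟨q, rfl⟩ := h
  have hn : (0 : ℤ) < n := by omega
  have h3 : q < 2 := by nlinarith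
  have h4 : -2 < q := by nlinarith
  obtain rfl | rfl | rfl : q = -1 ∨ q = 0 ∨ q = 1 := by omega
  all_goals simp

/-- Two blocked robots are blocked by the same edge, as only one is missing. -/
theorem Moves.one_le (h : Moves n u m mv) (hr : ¬ (m r).Halted) (hs : ¬ (m s).Halted)
    (he : ¬ SameEdge n (u r) (m r).dir (u s) (m s).dir) :
    1 ≤ (mv r).toNat + (mv s).toNat := by
  have := mt (h.blocked r s hr hs)
  cases h1 : mv r <;> cases h2 : mv s <;> simp_all

theorem sameEdge_left_left {u v : ℤ} : SameEdge n u .left v .left ↔ (n : ℤ) ∣ u - v := by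
  simp [SameEdge, Dir.opp]

theorem sameEdge_right_right {u v : ℤ} : SameEdge n u .right v .right ↔ (n : ℤ) ∣ u - v := by
  simp [SameEdge, Dir.opp]

theorem sameEdge_left_right {u v : ℤ} : SameEdge n u .left v .right ↔ (n : ℤ) ∣ u + 1 - v := by
  simp [SameEdge, Dir.opp, sg]

theorem move_left (h : (m r).dir = .left) : move u m mv r = u r + (mv r).toNat := by
  rw [move, h]
  cases mv r <;> rfl

theorem move_right (h : (m r).dir = .right) : move u m mv r = u r - (mv r).toNat := by
  rw [move, h]
  cases mv r <;> simp [sg, sub_eq_add_neg]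

theorem Cross.symm (h : Cross n u m mv r s) : Cross n u m mv s r := by
  obtain ⟨h1, h2, h3, h4⟩ := h
  refine ⟨h2, h1, by rw [h3, Dir.opp_opp], ?_⟩
  rw [h3, sg_opp, show u s + -sg (m r).dir - u r = -(u r + sg (m r).dir - u s) by ring, dvd_neg]
  exact h4

theorem Node.symm (h : Node n u r s) : Node n u s r := dvd_sub_comm.1 h

theorem not_cross_of_dir_eq (h : (m r).dir = (m s).dir) : ¬ Cross n u m mv r s := by
  rintro ⟨-, -, h3, -⟩
  rw [h] at h3
  cases hd : (m s).dir <;> simp [hd, Dir.opp] at h3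

theorem cross_left_right (hr : (m r).dir = .left) (hs : (m s).dir = .right) :
    Cross n u m mv r s ↔ (mv r).toNat = 1 ∧ (mv s).toNat = 1 ∧ (n : ℤ) ∣ u r + 1 - u s := by
  simp [Cross, hr, hs, Dir.opp, sg]

theorem not_cross_of_halted (h : Moves n u m mv) (hs : (m s).Halted) : ¬ Cross n u m mv r s := by
  rintro ⟨-, h2, -, -⟩
  rw [h.halted s hs] at h2
  exact absurd h2 (by simp)

theorem crossed_self (h : ∀ s, s ≠ r → ¬ Cross n u m mv r s) :
    crossed n u m mv r = (m r).afterMove (mv r) :=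
  exch_self fun s hs hc => absurd hc (h s hs)

theorem crossed_pair (ht : Tri a b c) (hab : Cross n u m mv a b) (ha : ¬ (m a).Halted)
    (hb : ¬ (m b).Halted) (hac : ¬ Cross n u m mv a c) :
    crossed n u m mv a = ((m a).afterMove (mv a)).meet [(m b).afterMove (mv b)] :=
  exch_pair ht hab (by rwa [Mem.halted_afterMove]) (by rwa [Mem.halted_afterMove])
    fun h => absurd h hac

theorem result_self (h : ∀ s, s ≠ r → Node n (move u m mv) r s → (crossed n u m mv s).Halted) :
    result n u m mv r = (crossed n u m mv r).expire := by
  rw [result, exch_self h]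

theorem result_pair (ht : Tri a b c) (hab : Node n (move u m mv) a b)
    (ha : ¬ (crossed n u m mv a).Halted) (hb : ¬ (crossed n u m mv b).Halted)
    (hac : Node n (move u m mv) a c → (crossed n u m mv c).Halted) :
    result n u m mv a = ((crossed n u m mv a).meet [crossed n u m mv b]).expire := by
  rw [result, exch_pair ht hab ha hb hac]

theorem exch_halted {rel : Fin 3 → Fin 3 → Prop} (h : (m r).Halted) : (exch rel m r).Halted := by
  simp [exch, exchange, h]

theorem crossed_halted (h : (m r).Halted) : (crossed n u m mv r).Halted :=
  exch_halted (by rwa [Mem.halted_afterMove])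

theorem result_halted_of_crossed (h : (crossed n u m mv r).Halted) :
    (result n u m mv r).Halted :=
  (exch_halted h).expire

theorem Tri.forall_ne (h : Tri a b c) {P : Fin 3 → Prop} (hb : P b) (hc : P c) :
    ∀ s, s ≠ a → P s := by
  intro s hs
  rcases h.cases s with rfl | rfl | rfl
  · exact absurd rfl hs
  · exact hb
  · exact hc

/-! ### Executions -/

variable {χ : Fin 3 → Bool} {missing : ℕ → Option (ZMod n)} {e : ℕ → Config n k}

/-- From each configuration to the next one there is a round of the algorithm. -/
def IsRun (χ : Fin 3 → Bool) (missing : ℕ → Option (ZMod n)) (e : ℕ → Config n k) : Prop :=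
  ∀ t, e (t + 1) = round χ (missing t) (e t)

/-- All robots have terminated at some time up to `T`. -/
def AllHaltedBy (e : ℕ → Config n k) (T : ℕ) : Prop :=
  ∃ t ≤ T, ∀ r, ((e t).mem r).Halted

theorem AllHaltedBy.mono {T T' : ℕ} (h : AllHaltedBy e T) (hT : T ≤ T') : AllHaltedBy e T' :=
  let ⟨t, ht, h⟩ := h
  ⟨t, ht.trans hT, h⟩

theorem prep_of_halted {β : Bool} (h : (m r).Halted) : prep χ β m r = m r :=
  prep_of_not_explore χ β m r (by rw [h]; simp)

theorem IsRun.view (he : IsRun χ missing e) {t : ℕ} {β : Bool} (h : View χ β (e t) u m) :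
    ∃ mv, Moves n u (prep χ β m) mv ∧
      View χ β (e (t + 1)) (move u (prep χ β m) mv) (result n u (prep χ β m) mv) := by
  rw [he t]
  exact h.round _

theorem IsRun.halted_succ (he : IsRun χ missing e) {t : ℕ} (h : ((e t).mem r).Halted) :
    ((e (t + 1)).mem r).Halted := by
  obtain ⟨u, m, hv⟩ := View.exists χ true (e t)
  obtain ⟨mv, -, hv'⟩ := he.view hv
  rw [hv.halted_iff] at h
  rw [hv'.halted_iff]
  refine result_halted_of_crossed (crossed_halted ?_)
  rwa [prep_of_halted h]

theorem IsRun.halted_of_le (he : IsRun χ missing e) {t t' : ℕ} (htt : t ≤ t')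
    (h : ((e t).mem r).Halted) : ((e t').mem r).Halted := by
  induction t', htt using Nat.le_induction with
  | base => exact h
  | succ t' _ ih => exact he.halted_succ ih

/-- Terminated robots take part in no meeting, so the last timer runs down undisturbed. As `expire`
acts at the end of each round, a running timer is positive between rounds; this is why `T = 0`
forces the second alternative of `hc`. -/
theorem allHaltedBy_of_alone (he : IsRun χ missing e) (ht : Tri a b c) {T t : ℕ}
    (ha : ((e t).mem a).Halted) (hb : ((e t).mem b).Halted)
    (hc : ((e t).mem c).proc = .startTermination T ∧ 1 ≤ T ∨ ((e t).mem c).Halted) :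
    AllHaltedBy e (t + T) := by
  induction T generalizing t with
  | zero =>
    refine ⟨t, le_rfl, fun r => ?_⟩
    rcases ht.cases r with rfl | rfl | rfl
    · exact ha
    · exact hb
    · simpa using hc
  | succ T ih =>
    have ha' := he.halted_succ ha
    have hb' := he.halted_succ hb
    refine (ih ha' hb' ?_).mono (by omega)
    rcases hc with ⟨hc, -⟩ | hc
    · obtain ⟨u, m, hv⟩ := View.exists χ true (e t)
      obtain ⟨mv, hmv, hv'⟩ := he.view hv
      rw [hv.halted_iff] at ha hb
      have hc' : prep χ true m c = ⟨(m c).id, (m c).dir, .startTermination (T + 1)⟩ := by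
        rw [← Mem.proc_translate (χ c == true), hv.mem] at hc
        rw [prep_of_not_explore _ _ _ _ (by rw [hc]; simp), ← hc]
      rw [← prep_of_halted (χ := χ) (β := true) ha] at ha
      rw [← prep_of_halted (χ := χ) (β := true) hb] at hb
      have hrot := ht.rotate.rotate
      have hres : result n u (prep χ true m) mv c =
          (⟨(m c).id, (m c).dir, .startTermination T⟩ : Mem k).expire := by
        rw [result_self (hrot.forall_ne (fun _ => crossed_halted ha) fun _ => crossed_halted hb),
          crossed_self (hrot.forall_ne (not_cross_of_halted hmv ha) (not_cross_of_halted hmv hb)),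
          hc', Mem.afterMove_term, Nat.add_sub_cancel]
      rw [hv'.halted_iff, ← Mem.proc_translate (χ c == true), hv'.mem, hres]
      cases T with
      | zero => exact .inr rfl
      | succ T => exact .inl ⟨rfl, by omega⟩
    · exact .inr (he.halted_succ hc)

theorem View.allHaltedBy (he : IsRun χ missing e) (ht : Tri a b c) {β : Bool} {T t : ℕ}
    {i : BitVec k} {d : Dir} (hv : View χ β (e t) u m) (ha : (m a).Halted) (hb : (m b).Halted)
    (hc : m c = (⟨i, d, .startTermination T⟩ : Mem k).expire) : AllHaltedBy e (t + T) := by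
  refine allHaltedBy_of_alone he ht ((hv.halted_iff a).2 ha) ((hv.halted_iff b).2 hb) ?_
  rw [hv.halted_iff, ← Mem.proc_translate (χ c == β), hv.mem, hc]
  cases T with
  | zero => exact .inr rfl
  | succ T => exact .inl ⟨rfl, by omega⟩

end DynRing

namespace DynRing

variable {n k : ℕ} {u : Fin 3 → ℤ} {m : Fin 3 → Mem k} {mv : Fin 3 → Bool}
  {χ : Fin 3 → Bool} {missing : ℕ → Option (ZMod n)} {e : ℕ → Config n k}

theorem Proc.mark_ne_explore (b : Bool) (s p t : ℕ) : mark b s ≠ .explore p t := by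
  cases b <;> simp [mark]

theorem Proc.cproc_ne_explore (b : Bool) (s v w : Option ℕ) (p t : ℕ) :
    cproc b s v w ≠ .explore p t := by
  cases b <;> simp [cproc]

theorem prep_eq_self {β : Bool} {a b c : Fin 3} (ht : Tri a b c)
    (ha : ∀ i t, (m a).proc ≠ .explore i t) (hb : ∀ i t, (m b).proc ≠ .explore i t)
    (hc : ∀ i t, (m c).proc ≠ .explore i t) : prep χ β m = m := by
  funext r
  apply prep_of_not_explore
  rcases ht.cases r with rfl | rfl | rfl <;> assumption

/-! ### The rounds after the exploration is complete -/

/-- `A` and `B` have met again and run towards `C` from both sides. -/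
theorem allHaltedBy_of_chase (hn : 3 ≤ n) (he : IsRun χ missing e) {β : Bool} {f g c : Fin 3}
    (ht : Tri f g c) {i j l : BitVec k} {T t z w : ℕ} {b : Bool} {s p q : Option ℕ}
    (hv : View χ β (e t) u m)
    (mf : m f = ⟨i, .left, .startTermination T⟩) (mg : m g = ⟨j, .right, .startTermination T⟩)
    (mc : m c = ⟨l, .left, cproc b s p q⟩)
    (uf : u f = u c - w + n) (ug : u g = u c + z - n) (hz : 1 ≤ z) (hw : 1 ≤ w) (hzw : z + w ≤ n)
    (hT : z + w ≤ T) : AllHaltedBy e (t + T) := by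
  induction T generalizing t u m z w s with
  | zero => omega
  | succ T ih =>
  obtain ⟨mv, hmv, hv'⟩ := he.view hv
  rw [prep_eq_self ht (by simp [mf]) (by simp [mg])
    (by simp [mc, Proc.cproc_ne_explore])] at hmv hv'
  have hf := Bool.toNat_le (mv f)
  have hg := Bool.toNat_le (mv g)
  have hc := Bool.toNat_le (mv c)
  have df : (m f).dir = .left := by rw [mf]
  have dg : (m g).dir = .right := by rw [mg]
  have dc : (m c).dir = .left := by rw [mc]
  have nf : ¬ (m f).Halted := by rw [mf]; simp
  have ng : ¬ (m g).Halted := by rw [mg]; simp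
  have nc : ¬ (m c).Halted := by rw [mc]; simp
  -- `f` approaches `C` from behind at distance `w`, `g` from the front at distance `z`. They use
  -- different edges, so `z + w` drops in every round and one of them meets `C` before the timers
  -- expire. Those two halt, and the third robot runs out its timer.
  have hfg := hmv.one_le nf ng (by
    rw [df, dg, sameEdge_left_right]
    intro h
    rcases dvd_cases h (by omega) (by omega) with h | h | h <;> omega)
  have hfc := hmv.one_le nf nc (by
    rw [df, dc, sameEdge_left_left]
    intro h
    rcases dvd_cases h (by omega) (by omega) with h | h | h <;> omega)
  have hcg : (mv c).toNat = 0 → (mv g).toNat = 0 → z = 1 := by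
    intro h1 h2
    by_contra h3
    have := hmv.one_le nc ng (by
      rw [dc, dg, sameEdge_left_right]
      intro h
      rcases dvd_cases h (by omega) (by omega) with h | h | h <;> omega)
    omega
  -- At distance one `C` and `g` share an edge: they cross it together or are both blocked.
  have hcg1 : z = 1 → mv c = mv g := by
    intro h
    apply hmv.same c g nc ng
    rw [dc, dg, sameEdge_left_right, show u c + 1 - u g = n by omega]
  have mvf := move_left (u := u) (mv := mv) df
  have mvg := move_right (u := u) (mv := mv) dg
  have mvc := move_left (u := u) (mv := mv) dc
  have xfg : ¬ Cross n u m mv f g := by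
    rw [cross_left_right df dg]
    rintro ⟨-, -, h⟩
    rcases dvd_cases h (by omega) (by omega) with h | h | h <;> omega
  have xfc : ¬ Cross n u m mv f c := not_cross_of_dir_eq (by rw [df, dc])
  have xf : crossed n u m mv f = ⟨i, .left, .startTermination T⟩ := by
    rw [crossed_self (ht.forall_ne xfg xfc), mf, Mem.afterMove_term, Nat.add_sub_cancel]
  by_cases hcross : z = 1 ∧ (mv c).toNat = 1
  · have hmcg := hcg1 hcross.1
    have xcg : Cross n u m mv c g := by
      rw [cross_left_right dc dg]
      refine ⟨hcross.2, hmcg ▸ hcross.2, ?_⟩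
      rw [show u c + 1 - u g = n by omega]
    have xc : (crossed n u m mv c).Halted := by
      rw [crossed_pair ht.rev xcg nc ng (fun h => xfc h.symm), mg]
      exact Mem.halted_meet_term ..
    have xg : (crossed n u m mv g).Halted := by
      rw [crossed_pair ht.rotate xcg.symm ng nc (fun h => xfg h.symm), mg]
      exact Mem.halted_term_meet ..
    refine (hv'.allHaltedBy he ht.rotate (result_halted_of_crossed xg)
      (result_halted_of_crossed xc) (T := T) (i := i) (d := .left) ?_).mono (by omega)
    rw [result_self (ht.forall_ne (fun _ => xg) fun _ => xc), xf]
  · have xcg : ¬ Cross n u m mv c g := by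
      rw [cross_left_right dc dg]
      rintro ⟨h1, -, h⟩
      rcases dvd_cases h (by omega) (by omega) with h | h | h <;> omega
    have xg : crossed n u m mv g = ⟨j, .right, .startTermination T⟩ := by
      rw [crossed_self (ht.swap.forall_ne (mt Cross.symm xfg) (mt Cross.symm xcg)), mg,
        Mem.afterMove_term, Nat.add_sub_cancel]
    have xc : crossed n u m mv c =
        ⟨l, .left, cproc b (s.map (· + (mv c).toNat)) p q⟩ := by
      rw [crossed_self (ht.rev.forall_ne xcg (mt Cross.symm xfc)), mc, Mem.afterMove_cproc]
    have hcg1' : z = 1 → (mv c).toNat = (mv g).toNat := fun h => by rw [hcg1 h]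
    have yfg : ¬ Node n (move u m mv) f g := by
      intro h
      rcases dvd_cases h (by omega) (by omega) with h | h | h <;> omega
    by_cases hz' : z = (mv c).toNat + (mv g).toNat
    · have ycg : Node n (move u m mv) c g := by
        rw [Node, mvc, mvg, show u c + (mv c).toNat - (u g - (mv g).toNat) = n by omega]
      have yfc : ¬ Node n (move u m mv) f c := by
        intro h
        rcases dvd_cases h (by omega) (by omega) with h | h | h <;> omega
      refine (hv'.allHaltedBy he ht.rotate (T := T) (i := i) (d := .left) ?_ ?_ ?_).mono (by omega)
      rotate_right
      · rw [result_self (ht.forall_ne (absurd · yfg) (absurd · yfc)), xf]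
      · rw [result_pair ht.rotate ycg.symm (by simp [xg]) (by simp [xc])
          (fun h => absurd h.symm yfg), xg]
        exact (Mem.halted_term_meet ..).expire
      · rw [result_pair ht.rev ycg (by simp [xc]) (by simp [xg])
          (fun h => absurd h.symm yfc), xg]
        exact (Mem.halted_meet_term ..).expire
    · have ycg : ¬ Node n (move u m mv) c g := by
        intro h
        rcases dvd_cases h (by omega) (by omega) with h | h | h <;> omega
      have hg' : result n u m mv g = (⟨j, .right, .startTermination T⟩ : Mem k).expire := by
        rw [result_self (ht.swap.forall_ne (absurd ·.symm yfg) (absurd ·.symm ycg)), xg]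
      -- `f` catches `C`: this forces `w = 1`, `C` blocked and `f` moving.
      by_cases hw' : w + (mv c).toNat = (mv f).toNat
      · have yfc : Node n (move u m mv) f c := by
          rw [Node, mvf, mvc, show u f + (mv f).toNat - (u c + (mv c).toNat) = n by omega]
        refine (hv'.allHaltedBy he ht.rotate.rotate (T := T) ?_ ?_ hg').mono (by omega)
        · rw [result_pair ht.rotate.rotate yfc.symm (by simp [xc]) (by simp [xf])
            (fun h => absurd h ycg), xf]
          exact (Mem.halted_meet_term ..).expire
        · rw [result_pair ht.rotate.rev yfc (by simp [xf]) (by simp [xc])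
            (fun h => absurd h yfg), xf]
          exact (Mem.halted_term_meet ..).expire
      · have yfc : ¬ Node n (move u m mv) f c := by
          intro h
          rcases dvd_cases h (by omega) (by omega) with h | h | h <;> omega
        rw [Mem.expire_term _ _ (by omega)] at hg'
        refine (ih (z := z - (mv c).toNat - (mv g).toNat) (w := w + (mv c).toNat - (mv f).toNat)
          (s := s.map (· + (mv c).toNat))
          hv' ?_ hg' ?_ ?_ ?_ ?_ ?_ ?_ ?_).mono (by omega) <;> try omega
        · rw [result_self (ht.forall_ne (absurd · yfg) (absurd · yfc)), xf,
            Mem.expire_term _ _ (by omega)]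
        · rw [result_self (ht.rev.forall_ne (absurd · ycg) (absurd ·.symm yfc)), xc,
            Mem.expire_cproc]

/-- `A` and `B` face each other on both sides of an edge, one of them knows that the exploration is
complete, and `C`, who also knows it, runs to the other one. -/
theorem allHaltedBy_of_facing (hn : 3 ≤ n) (he : IsRun χ missing e) {β : Bool} {f g c : Fin 3}
    (ht : Tri f g c) {i j l : BitVec k} {T t z y : ℕ} {b : Bool}
    (hv : View χ β (e t) u m)
    (mf : m f = ⟨i, .right, .startTermination T⟩) (mg : m g = ⟨j, .left, mark b y⟩)
    (mc : m c = ⟨l, .left, .startTermination T⟩)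
    (uf : u f = u g + 1 - n) (ug : u g = u c + z) (hz : 1 ≤ z) (hzn : z < n)
    (hT : z + 1 ≤ T) : AllHaltedBy e (t + T) := by
  induction T generalizing t u m z y with
  | zero => omega
  | succ T ih =>
  obtain ⟨mv, hmv, hv'⟩ := he.view hv
  rw [prep_eq_self ht (by simp [mf]) (by simp [mg, Proc.mark_ne_explore])
    (by simp [mc])] at hmv hv'
  have df : (m f).dir = .right := by rw [mf]
  have dg : (m g).dir = .left := by rw [mg]
  have dc : (m c).dir = .left := by rw [mc]
  have nf : ¬ (m f).Halted := by rw [mf]; simp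
  have ng : ¬ (m g).Halted := by rw [mg]; simp
  have nc : ¬ (m c).Halted := by rw [mc]; simp
  have hgc := hmv.one_le ng nc (by
    rw [dg, dc, sameEdge_left_left]
    intro h
    rcases dvd_cases h (by omega) (by omega) with h | h | h <;> omega)
  -- `f` and `g` are at the two ends of one edge. If it is present they cross and both halt; if not,
  -- nothing else is missing and `C` gets closer to `g`.
  have hfg : mv g = mv f := hmv.same g f ng nf (by
    rw [dg, df, sameEdge_left_right, show u g + 1 - u f = n by omega])
  have mvf := move_right (u := u) (mv := mv) df
  have mvg := move_left (u := u) (mv := mv) dg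
  have mvc := move_left (u := u) (mv := mv) dc
  have xcf : ¬ Cross n u m mv c f := by
    rw [cross_left_right dc df]
    rintro ⟨-, -, h⟩
    rcases dvd_cases h (by omega) (by omega) with h | h | h <;> omega
  have xcg : ¬ Cross n u m mv c g := not_cross_of_dir_eq (by rw [dc, dg])
  have xc : crossed n u m mv c = ⟨l, .left, .startTermination T⟩ := by
    rw [crossed_self (ht.rev.forall_ne xcg xcf), mc, Mem.afterMove_term, Nat.add_sub_cancel]
  cases hg : mv g with
  | true =>
    have xgf : Cross n u m mv g f := by
      rw [cross_left_right dg df, ← hfg, hg, show u g + 1 - u f = n by omega]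
      simp
    have xf : (crossed n u m mv f).Halted := by
      rw [crossed_pair ht xgf.symm nf ng (mt Cross.symm xcf), mf]
      exact Mem.halted_term_meet ..
    have xg : (crossed n u m mv g).Halted := by
      rw [crossed_pair ht.swap xgf ng nf (mt Cross.symm xcg), mf]
      exact Mem.halted_meet_term ..
    refine (hv'.allHaltedBy he ht (result_halted_of_crossed xf)
      (result_halted_of_crossed xg) (T := T) (i := l) (d := .left) ?_).mono (by omega)
    rw [result_self (ht.rev.forall_ne (fun _ => xg) fun _ => xf), xc]
  | false =>
    have hf : mv f = false := by rw [← hfg, hg]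
    have hc : mv c = true := by
      cases h : mv c
      · simp [hg, h] at hgc
      · rfl
    have xgf : ¬ Cross n u m mv g f := fun h => absurd h.1 (by simp [hg])
    have xf : crossed n u m mv f = ⟨i, .right, .startTermination T⟩ := by
      rw [crossed_self (ht.forall_ne (mt Cross.symm xgf) (mt Cross.symm xcf)), mf,
        Mem.afterMove_term, Nat.add_sub_cancel]
    have xg : crossed n u m mv g = ⟨j, .left, mark b y⟩ := by
      rw [crossed_self (ht.swap.forall_ne xgf (mt Cross.symm xcg)), mg, Mem.afterMove_mark, hg]
      rfl
    simp only [hf, hg, hc, Bool.toNat_false, Bool.toNat_true] at mvf mvg mvc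
    have yfg : ¬ Node n (move u m mv) f g := by
      intro h
      rcases dvd_cases h (by omega) (by omega) with h | h | h <;> omega
    have yfc : ¬ Node n (move u m mv) f c := by
      intro h
      rcases dvd_cases h (by omega) (by omega) with h | h | h <;> omega
    have hf' : result n u m mv f = (⟨i, .right, .startTermination T⟩ : Mem k).expire := by
      rw [result_self (ht.forall_ne (absurd · yfg) (absurd · yfc)), xf]
    by_cases hz1 : z = 1
    · have ycg : Node n (move u m mv) c g := by
        rw [Node, mvc, mvg, show u c + (1 : ℕ) - (u g + (0 : ℕ)) = 0 by omega]
        exact dvd_zero _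
      refine (hv'.allHaltedBy he ht.rotate (T := T) ?_ ?_ hf').mono (by omega)
      · rw [result_pair ht.rotate ycg.symm (by simp [xg]) (by simp [xc])
          (fun h => absurd h.symm yfg), xc]
        exact (Mem.halted_meet_term ..).expire
      · rw [result_pair ht.rev ycg (by simp [xc]) (by simp [xg])
          (fun h => absurd h.symm yfc), xc]
        exact (Mem.halted_term_meet ..).expire
    · have ycg : ¬ Node n (move u m mv) c g := by
        intro h
        rcases dvd_cases h (by omega) (by omega) with h | h | h <;> omega
      rw [Mem.expire_term _ _ (by omega)] at hf'
      refine (ih (z := z - 1) (y := y) hv' hf' ?_ ?_ ?_ ?_ ?_ ?_ ?_).mono (by omega) <;> try omega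
      · rw [result_self (ht.swap.forall_ne (absurd ·.symm yfg) (absurd ·.symm ycg)), xg,
          Mem.expire_mark]
      · rw [result_self (ht.rev.forall_ne (absurd · ycg) (absurd ·.symm yfc)), xc,
          Mem.expire_term _ _ (by omega)]

end DynRing

namespace DynRing

variable {n k : ℕ} {u : Fin 3 → ℤ} {m : Fin 3 → Mem k} {mv : Fin 3 → Bool}
  {χ : Fin 3 → Bool} {missing : ℕ → Option (ZMod n)} {e : ℕ → Config n k}

/-! ### Visited nodes -/

/-- The nodes with coordinates from `lo` to `hi` have been visited within the first `t` rounds. -/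
def VisitedArc (e : ℕ → Config n k) (t : ℕ) (β : Bool) (lo hi : ℤ) : Prop :=
  ∀ z, lo ≤ z → z ≤ hi → ∃ t' ≤ t, ∃ r : Fin 3, (e t').pos r = ((ori β * z : ℤ) : ZMod n)

theorem VisitedArc.flip {t : ℕ} {β : Bool} {lo hi : ℤ} (h : VisitedArc e t β lo hi) :
    VisitedArc e t (!β) (-hi) (-lo) := by
  intro z h1 h2
  obtain ⟨t', ht, r, hr⟩ := h (-z) (by omega) (by omega)
  refine ⟨t', ht, r, ?_⟩
  rw [hr, ori_not, neg_mul, mul_neg]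

/-- Each end advances by at most one node, and both new ends are occupied at time `t + 1`. -/
theorem VisitedArc.extend {t : ℕ} {β : Bool} {lo hi lo' hi' : ℤ} {r s : Fin 3}
    (h : VisitedArc e t β lo hi) (hv : View χ β (e (t + 1)) u m) (hr : u r = lo') (hs : u s = hi')
    (h1 : lo - 1 ≤ lo') (h2 : hi' ≤ hi + 1) : VisitedArc e (t + 1) β lo' hi' := by
  intro z hz1 hz2
  by_cases hz : lo ≤ z ∧ z ≤ hi
  · obtain ⟨t', ht, h⟩ := h z hz.1 hz.2
    exact ⟨t', by omega, h⟩
  · rcases (by omega : z = lo' ∨ z = hi') with rfl | rfl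
    · exact ⟨t + 1, le_rfl, r, by rw [hv.pos, hr]⟩
    · exact ⟨t + 1, le_rfl, s, by rw [hv.pos, hs]⟩

theorem VisitedArc.of_view {t : ℕ} {β : Bool} {lo hi : ℤ} {r s : Fin 3}
    (hv : View χ β (e t) u m) (hr : u r = lo) (hs : u s = hi) (h : hi ≤ lo + 1) :
    VisitedArc e t β lo hi := by
  intro z hz1 hz2
  rcases (by omega : z = lo ∨ z = hi) with rfl | rfl
  · exact ⟨t, le_rfl, r, by rw [hv.pos, hr]⟩
  · exact ⟨t, le_rfl, s, by rw [hv.pos, hs]⟩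

theorem VisitedArc.exploredBy {t : ℕ} {β : Bool} {lo hi : ℤ} (h : VisitedArc e t β lo hi)
    (hn : 0 < n) (hlen : lo + n ≤ hi + 1) : ExploredBy e t := by
  intro v
  obtain ⟨w, hw⟩ := ZMod.intCast_surjective ((ori β : ZMod n) * v)
  have hpos : (0 : ℤ) < n := by omega
  have h1 := Int.emod_nonneg (w - lo) hpos.ne'
  have h2 := Int.emod_lt_of_pos (w - lo) hpos
  obtain ⟨t', ht, r, hr⟩ := h (lo + (w - lo) % n) (by omega) (by omega)
  refine ⟨t', ht, r, ?_⟩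
  have h3 : ((lo + (w - lo) % n : ℤ) : ZMod n) = (w : ZMod n) := by
    rw [← sub_eq_zero, ← Int.cast_sub, ZMod.intCast_zmod_eq_zero_iff_dvd]
    refine ⟨-((w - lo) / n), ?_⟩
    have := Int.emod_add_mul_ediv (w - lo) n
    linarith
  rw [hr, Int.cast_mul, h3, hw]
  cases β <;> simp [ori]

theorem ExploredBy.mono {t t' : ℕ} (h : ExploredBy e t) (ht : t ≤ t') : ExploredBy e t' :=
  fun v => let ⟨t₀, h₀, h⟩ := h v; ⟨t₀, h₀.trans ht, h⟩

/-- From time `t` on, robots terminate only when all nodes have been visited, and all robots have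
terminated by time `T`. -/
structure Finishes (e : ℕ → Config n k) (t T : ℕ) : Prop where
  safe : ∀ t' ≥ t, ∀ r, ((e t').mem r).Halted → ExploredBy e t'
  halted : AllHaltedBy e T

theorem Finishes.of_explored {t T : ℕ} (h : ExploredBy e t) (hT : AllHaltedBy e T) :
    Finishes e t T :=
  ⟨fun _ ht _ _ => h.mono ht, hT⟩

theorem Finishes.mono {t T T' : ℕ} (h : Finishes e t T) (hT : T ≤ T') : Finishes e t T' :=
  ⟨h.safe, h.halted.mono hT⟩

theorem Finishes.of_succ {t T : ℕ} (h : Finishes e (t + 1) T)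
    (ht : ∀ r, ¬ ((e t).mem r).Halted) : Finishes e t T := by
  refine ⟨fun t' ht' r hr => ?_, h.halted⟩
  rcases ht'.eq_or_lt with rfl | h'
  · exact absurd hr (ht r)
  · exact h.safe t' h' r hr

/-! ### The robot `C` between `A` and `B` -/

/-- `C` heads for the robot `f` and has left the robot `g`, where `f` and `g` are `A` and `B`. -/
structure Leg (χ : Fin 3 → Bool) (e : ℕ → Config n k) (t : ℕ) (x y : ℕ) (s v : Option ℕ) : Prop
    where
  data : ∃ (β : Bool) (u : Fin 3 → ℤ) (m : Fin 3 → Mem k) (f g c : Fin 3) (i j l : BitVec k)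
    (b : Bool) (p q : ℕ) (w : Option ℕ), View χ β (e t) u m ∧ Tri f g c ∧
    m f = ⟨i, .left, mark b p⟩ ∧ m g = ⟨j, .right, mark (!b) q⟩ ∧ m c = ⟨l, .left, cproc b s v w⟩ ∧
    u f = u c + x ∧ u g = u c - y ∧ (p + q = x + y ∨ p + q + 1 = x + y) ∧
    VisitedArc e t β (u g) (u f)
  pos : 1 ≤ x
  len : x + y + 1 ≤ n
  le : ∀ s₀, s = some s₀ → s₀ ≤ y
  lt_or_eq : ∀ s₀ v₀, s = some s₀ → v = some v₀ → v₀ < s₀ + x ∨ v₀ + 1 = n ∧ s₀ + x + 1 = n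

/-- A bound for the number of rounds before the detection. -/
def legRank (n x y : ℕ) (s v : Option ℕ) : ℕ :=
  if x + y + 1 < n then 3 * (n - 1) + (n - 1 - (x + y))
  else if s = some y then (if v = some (n - 1) then x else x + (n - 1))
  else x + 2 * (n - 1)

theorem agree_eq_some {s v : Option ℕ} {d : ℕ} (h : agree s v = some d) :
    s = some d ∧ v = some d := by
  rcases s with _ | s <;> rcases v with _ | v <;> simp [agree] at h
  simp [← h.2, h.1]

/-- As long as `x + y + 1 < n`, the arc grows. Once `x + y + 1 = n`, either `f` and `g` cross or
both are blocked and `C` advances. Then `s = some y` means that the current leg will end with count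
`n - 1`, and `v = some (n - 1)` that this count will agree with the previous one; these are the
cases of `legRank`. The bound `n + 2` is that of the timer `p + q + 3`, where `p + q ≤ n - 1`. -/
theorem Leg.step (hn : 3 ≤ n) (he : IsRun χ missing e) {t x y : ℕ} {s v : Option ℕ}
    (h : Leg χ e t x y s v) :
    (∃ x' y' s' v', Leg χ e (t + 1) x' y' s' v' ∧ legRank n x' y' s' v' < legRank n x y s v) ∨
      Finishes e (t + 1) (t + 1 + (n + 2)) := by
  obtain ⟨⟨β, u, m, f, g, c, i, j, l, b, p, q, w, hv, ht, mf, mg, mc, uf, ug, hpq, hvis⟩,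
    hx, hxy, hle, hagree⟩ := h
  obtain ⟨mv, hmv, hv'⟩ := he.view hv
  rw [prep_eq_self ht (by simp [mf, Proc.mark_ne_explore]) (by simp [mg, Proc.mark_ne_explore])
    (by simp [mc, Proc.cproc_ne_explore])] at hmv hv'
  have hf := Bool.toNat_le (mv f)
  have hg := Bool.toNat_le (mv g)
  have hc := Bool.toNat_le (mv c)
  have df : (m f).dir = .left := by rw [mf]
  have dg : (m g).dir = .right := by rw [mg]
  have dc : (m c).dir = .left := by rw [mc]
  have nf : ¬ (m f).Halted := by rw [mf]; simp
  have ng : ¬ (m g).Halted := by rw [mg]; simp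
  have nc : ¬ (m c).Halted := by rw [mc]; simp
  have hfc := hmv.one_le nf nc (by
    rw [df, dc, sameEdge_left_left]
    intro h
    rcases dvd_cases h (by omega) (by omega) with h | h | h <;> omega)
  have hgc := hmv.one_le nc ng (by
    rw [dc, dg, sameEdge_left_right]
    intro h
    rcases dvd_cases h (by omega) (by omega) with h | h | h <;> omega)
  have hfg : x + y + 1 < n → 1 ≤ (mv f).toNat + (mv g).toNat := by
    intro h1
    refine hmv.one_le nf ng ?_
    rw [df, dg, sameEdge_left_right]
    intro h
    rcases dvd_cases h (by omega) (by omega) with h | h | h <;> omega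
  -- On a full arc `f` and `g` share the last edge.
  have hfg1 : x + y + 1 = n → (mv f).toNat = (mv g).toNat := by
    intro h
    rw [hmv.same f g nf ng]
    rw [df, dg, sameEdge_left_right, show u f + 1 - u g = n by omega]
  have mvf := move_left (u := u) (mv := mv) df
  have mvg := move_right (u := u) (mv := mv) dg
  have mvc := move_left (u := u) (mv := mv) dc
  have xfc : ¬ Cross n u m mv f c := not_cross_of_dir_eq (by rw [df, dc])
  have xcg : ¬ Cross n u m mv c g := by
    rw [cross_left_right dc dg]
    rintro ⟨-, -, h⟩
    rcases dvd_cases h (by omega) (by omega) with h | h | h <;> omega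
  have xc : crossed n u m mv c = ⟨l, .left, cproc b (s.map (· + (mv c).toNat)) v w⟩ := by
    rw [crossed_self (ht.rev.forall_ne xcg (mt Cross.symm xfc)), mc, Mem.afterMove_cproc]
  have hvis' : VisitedArc e (t + 1) β (move u m mv g) (move u m mv f) :=
    hvis.extend hv' rfl rfl (by omega) (by omega)
  by_cases hcross : x + y + 1 = n ∧ (mv f).toNat = 1
  · have hexp : ExploredBy e (t + 1) := (hvis.exploredBy (by omega) (by omega)).mono (by omega)
    refine .inr (Finishes.of_explored hexp ?_)
    have hg1 := (hfg1 hcross.1).symm.trans hcross.2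
    have xfg : Cross n u m mv f g := by
      rw [cross_left_right df dg, show u f + 1 - u g = n by omega]
      exact ⟨hcross.2, hg1, dvd_rfl⟩
    -- The crossing move is included in both counts: the timer is `(p + 1) + (q + 1) + 1`.
    have xf : crossed n u m mv f = ⟨i, .left, .startTermination (p + q + 3)⟩ := by
      rw [crossed_pair ht xfg nf ng xfc, mf, mg, Mem.afterMove_mark, Mem.afterMove_mark,
        Mem.meet_mark_mark, hcross.2, hg1]
      congr 2
      omega
    have xg : crossed n u m mv g = ⟨j, .right, .startTermination (p + q + 3)⟩ := by
      have := Mem.meet_mark_mark j i .right .left (!b) (q + 1) (p + 1)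
      rw [Bool.not_not] at this
      rw [crossed_pair ht.swap xfg.symm ng nf (mt Cross.symm xcg), mf, mg, Mem.afterMove_mark,
        Mem.afterMove_mark, hcross.2, hg1, this]
      congr 2
      omega
    have yfg : ¬ Node n (move u m mv) f g := by
      intro h
      rcases dvd_cases h (by omega) (by omega) with h | h | h <;> omega
    -- `g` arrives at the node left by `f`. `C` is there too only if it reached this node in the
    -- same round.
    by_cases hz : x = (mv c).toNat
    · have ycg : Node n (move u m mv) c g := by
        rw [Node, show move u m mv c - move u m mv g = n by omega]
      have yfc : ¬ Node n (move u m mv) f c := by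
        intro h
        rcases dvd_cases h (by omega) (by omega) with h | h | h <;> omega
      refine (hv'.allHaltedBy he ht.rotate (T := p + q + 3) (i := i) (d := .left)
        ?_ ?_ ?_).mono (by omega)
      · rw [result_pair ht.rotate ycg.symm (by simp [xg]) (by simp [xc])
          (fun h => absurd h.symm yfg), xg]
        exact (Mem.halted_term_meet ..).expire
      · rw [result_pair ht.rev ycg (by simp [xc]) (by simp [xg])
          (fun h => absurd h.symm yfc), xg]
        exact (Mem.halted_meet_term ..).expire
      · rw [result_self (ht.forall_ne (absurd · yfg) (absurd · yfc)), xf]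
    · have ycg : ¬ Node n (move u m mv) c g := by
        intro h
        rcases dvd_cases h (by omega) (by omega) with h | h | h <;> omega
      have hg' : result n u m mv g = (⟨j, .right, .startTermination (p + q + 3)⟩ : Mem k) := by
        rw [result_self (ht.swap.forall_ne (absurd ·.symm yfg) (absurd ·.symm ycg)), xg,
          Mem.expire_term _ _ (by omega)]
      -- `f` arrives at the node left by `g`. `C` is there too only if it started the round at this
      -- node and was blocked.
      by_cases hw : y + (mv c).toNat = 0
      · have yfc : Node n (move u m mv) f c := by
          rw [Node, show move u m mv f - move u m mv c = n by omega]
        refine (hv'.allHaltedBy he ht.rotate.rotate (T := p + q + 3) (i := j) (d := .right)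
          ?_ ?_ hg').mono (by omega)
        · rw [result_pair ht.rotate.rotate yfc.symm (by simp [xc]) (by simp [xf])
            (fun h => absurd h ycg), xf]
          exact (Mem.halted_meet_term ..).expire
        · rw [result_pair ht.rotate.rev yfc (by simp [xf]) (by simp [xc])
            (fun h => absurd h yfg), xf]
          exact (Mem.halted_term_meet ..).expire
      · have yfc : ¬ Node n (move u m mv) f c := by
          intro h
          rcases dvd_cases h (by omega) (by omega) with h | h | h <;> omega
        refine (allHaltedBy_of_chase hn he ht (z := x - (mv c).toNat) (w := y + (mv c).toNat)
          (i := i) (j := j) (l := l) (b := b) (s := s.map (· + (mv c).toNat)) (p := v) (q := w)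
          (T := p + q + 3) hv' ?_ hg' ?_ ?_ ?_ ?_ ?_ ?_ ?_).mono (by omega) <;> try omega
        · rw [result_self (ht.forall_ne (absurd · yfg) (absurd · yfc)), xf,
            Mem.expire_term _ _ (by omega)]
        · rw [result_self (ht.rev.forall_ne (absurd · ycg) (absurd ·.symm yfc)), xc,
            Mem.expire_cproc]
  · have xfg : ¬ Cross n u m mv f g := by
      rw [cross_left_right df dg]
      rintro ⟨h1, -, h⟩
      rcases dvd_cases h (by omega) (by omega) with h | h | h <;> omega
    have xf : crossed n u m mv f = ⟨i, .left, mark b (p + (mv f).toNat)⟩ := by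
      rw [crossed_self (ht.forall_ne xfg xfc), mf, Mem.afterMove_mark]
    have xg : crossed n u m mv g = ⟨j, .right, mark (!b) (q + (mv g).toNat)⟩ := by
      rw [crossed_self (ht.swap.forall_ne (mt Cross.symm xfg) (mt Cross.symm xcg)), mg,
        Mem.afterMove_mark]
    have ycg : ¬ Node n (move u m mv) c g := by
      intro h
      rcases dvd_cases h (by omega) (by omega) with h | h | h <;> omega
    -- A single node was left outside the arc, and `f` and `g` both step onto it.
    by_cases hmeet : x + y + (mv f).toNat + (mv g).toNat = n
    · have yfg : Node n (move u m mv) f g := by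
        rw [Node, show move u m mv f - move u m mv g = n by omega]
      have yfc : ¬ Node n (move u m mv) f c := by
        intro h
        rcases dvd_cases h (by omega) (by omega) with h | h | h <;> omega
      refine .inr (Finishes.of_explored (hvis'.exploredBy (by omega) (by omega)) ?_)
      refine (allHaltedBy_of_chase hn he ht (z := x + (mv f).toNat - (mv c).toNat)
        (w := y + (mv g).toNat + (mv c).toNat)
        (i := i) (j := j) (l := l) (b := b) (s := s.map (· + (mv c).toNat)) (p := v) (q := w)
        (T := p + q + 3) hv' ?_ ?_ ?_ ?_ ?_ ?_ ?_ ?_ ?_).mono (by omega) <;> try omega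
      · rw [result_pair ht yfg (by simp [xf]) (by simp [xg]) (absurd · yfc), xf, xg,
          Mem.meet_mark_mark, Mem.expire_term _ _ (by omega)]
        congr 2
        omega
      · have := Mem.meet_mark_mark j i .right .left (!b) (q + (mv g).toNat) (p + (mv f).toNat)
        rw [Bool.not_not] at this
        rw [result_pair ht.swap yfg.symm (by simp [xg]) (by simp [xf]) (absurd ·.symm ycg), xf, xg,
          this, Mem.expire_term _ _ (by omega)]
        congr 2
        omega
      · rw [result_self (ht.rev.forall_ne (absurd · ycg) (absurd ·.symm yfc)), xc,
          Mem.expire_cproc]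
    · have yfg : ¬ Node n (move u m mv) f g := by
        intro h
        rcases dvd_cases h (by omega) (by omega) with h | h | h <;> omega
      have hg' : result n u m mv g = ⟨j, .right, mark (!b) (q + (mv g).toNat)⟩ := by
        rw [result_self (ht.swap.forall_ne (absurd ·.symm yfg) (absurd ·.symm ycg)), xg,
          Mem.expire_mark]
      -- Arrival forces `x = 1`, `f` blocked and `C` moving.
      by_cases harr : x + (mv f).toNat = (mv c).toNat
      · have yfc : Node n (move u m mv) f c := by
          rw [Node, show move u m mv f - move u m mv c = 0 by omega]
          exact dvd_zero _
        have hf' : result n u m mv f = ((⟨i, .left, (agree (s.map (· + (mv c).toNat)) v).elim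
            (mark b (p + (mv f).toNat)) (fun c => .startTermination (c + 1))⟩ : Mem k)).expire := by
          rw [result_pair ht.rotate.rev yfc (by simp [xf]) (by simp [xc])
            (fun h => absurd h yfg), xf, xc, Mem.meet_mark_cproc]
        have hc' : result n u m mv c = ((⟨l, .right, (agree (s.map (· + (mv c).toNat)) v).elim
            (cproc (!b) (some 0) (s.map (· + (mv c).toNat)) v)
            (fun c => .startTermination (c + 1))⟩ : Mem k)).expire := by
          rw [result_pair ht.rotate.rotate yfc.symm (by simp [xc]) (by simp [xf])
            (fun h => absurd h ycg), xf, xc, Mem.meet_cproc_mark]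
          rfl
        rcases hag : agree (s.map (· + (mv c).toNat)) v with _ | d
        · left
          rw [hag, Option.elim_none, Mem.expire_mark] at hf'
          rw [hag, Option.elim_none, Mem.expire_cproc] at hc'
          -- `C` turns round: in the reflected view `f` and `g` exchange their roles, and the
          -- finished count becomes the one to compare with.
          refine ⟨y + 1 + (mv g).toNat, 0, some 0, s.map (· + (mv c).toNat),
            ⟨⟨!β, _, _, g, f, c, j, i, l, !b, q + (mv g).toNat, p + (mv f).toNat, v, hv'.flip,
              ht.swap, by rw [hg']; rfl, by rw [hf', Bool.not_not]; rfl, by rw [hc']; rfl,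
              by omega, by omega, by omega, hvis'.flip⟩, by omega, by omega, ?_, ?_⟩, ?_⟩
          · rintro _ ⟨⟩
            omega
          -- The finished count is at most `y + 1`, while the way back is `y + 1 + (mv g).toNat`. As
          -- `f` was blocked, `g` moved, unless the two share the last edge; only then can both
          -- lengths be equal, with value `n - 1`.
          · rintro _ v₀ ⟨⟩ h
            obtain ⟨s₀, rfl, rfl⟩ := Option.map_eq_some_iff.1 h
            have := hle s₀ rfl
            omega
          -- On a full arc the new leg starts with `s = y = 0`; if the finished one was complete,
          -- the new `v` is `n - 1`.
          · simp only [legRank]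
            rcases s with _ | s₀
            · simp only [Option.map_none, reduceCtorEq, if_true, if_false]
              split_ifs <;> omega
            · rcases v with _ | v₀
              · simp only [Option.map_some, Option.some.injEq, reduceCtorEq, if_true, if_false]
                split_ifs <;> omega
              · simp only [Option.map_some, agree, ite_eq_right_iff, reduceCtorEq, imp_false] at hag
                simp only [Option.map_some, Option.some.injEq, if_true]
                have := hagree s₀ v₀ rfl rfl
                split_ifs <;> omega
        · right
          rw [hag, Option.elim_some, Mem.expire_term_succ] at hf' hc'
          obtain ⟨h1, rfl⟩ := agree_eq_some hag
          obtain ⟨s₀, rfl, hs₀⟩ := Option.map_eq_some_iff.1 h1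
          -- Agreement means `d = s₀ + x` with `x = 1`. This excludes the strict alternative, so `d
          -- = n - 1` and the arc is full.
          have h2 := hagree s₀ d rfl rfl
          have h3 := hle s₀ rfl
          refine Finishes.of_explored (hvis'.exploredBy (by omega) (by omega)) ?_
          refine (allHaltedBy_of_facing hn he ht (z := n - 1) (i := i) (j := j) (l := l)
            (T := d + 1) hv'.flip (by rw [hf']; rfl) (by rw [hg']; rfl) (by rw [hc']; rfl)
            ?_ ?_ ?_ ?_ ?_).mono (by omega) <;> omega
      · have yfc : ¬ Node n (move u m mv) f c := by
          intro h
          rcases dvd_cases h (by omega) (by omega) with h | h | h <;> omega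
        left
        refine ⟨x + (mv f).toNat - (mv c).toNat, y + (mv g).toNat + (mv c).toNat,
          s.map (· + (mv c).toNat), v,
          ⟨⟨β, _, _, f, g, c, i, j, l, b, p + (mv f).toNat, q + (mv g).toNat, w, hv',
            ht, ?_, hg', ?_,
            by omega, by omega, by omega, hvis'⟩, by omega, by omega, ?_, ?_⟩, ?_⟩
        · rw [result_self (ht.forall_ne (absurd · yfg) (absurd · yfc)), xf, Mem.expire_mark]
        · rw [result_self (ht.rev.forall_ne (absurd · ycg) (absurd ·.symm yfc)), xc,
            Mem.expire_cproc]
        · intro s₀ h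
          obtain ⟨s₀, rfl, rfl⟩ := Option.map_eq_some_iff.1 h
          have := hle s₀ rfl
          omega
        · intro s₀ v₀ h h'
          obtain ⟨s₀, rfl, rfl⟩ := Option.map_eq_some_iff.1 h
          have := hagree s₀ v₀ rfl h'
          have := hle s₀ rfl
          omega
        · simp only [legRank]
          rcases s with _ | s₀
          · simp only [Option.map_none, reduceCtorEq, if_false]
            split_ifs <;> omega
          · simp only [Option.map_some, Option.some.injEq]
            split_ifs <;> omega

theorem Leg.not_halted {t x y : ℕ} {s v : Option ℕ} (h : Leg χ e t x y s v) (r : Fin 3) :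
    ¬ ((e t).mem r).Halted := by
  obtain ⟨β, u, m, f, g, c, i, j, l, b, p, q, w, hv, ht, mf, mg, mc, -⟩ := h.data
  rw [hv.halted_iff]
  rcases ht.cases r with rfl | rfl | rfl
  · simp [mf]
  · simp [mg]
  · simp [mc]

theorem Leg.finishes (hn : 3 ≤ n) (he : IsRun χ missing e) {t x y : ℕ} {s v : Option ℕ}
    (h : Leg χ e t x y s v) : Finishes e t (t + legRank n x y s v + (n + 2)) := by
  induction hN : legRank n x y s v using Nat.strong_induction_on generalizing t x y s v with
  | _ N ih =>
  subst hN
  refine Finishes.of_succ ?_ h.not_halted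
  rcases h.step hn he with ⟨x', y', s', v', h', hlt⟩ | h'
  · exact (ih _ hlt h' rfl).mono (by omega)
  · refine h'.mono ?_
    have : 1 ≤ legRank n x y s v := by
      have := h.pos
      rw [legRank]
      split_ifs <;> omega
    omega

theorem legRank_le {x y : ℕ} (s v : Option ℕ) (hx : x + y + 1 ≤ n) :
    legRank n x y s v ≤ 3 * (n - 1) + (n - 1 - (x + y)) := by
  rw [legRank]
  split_ifs <;> omega

end DynRing

namespace DynRing

variable {n k : ℕ} {u : Fin 3 → ℤ} {m : Fin 3 → Mem k} {mv : Fin 3 → Bool}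
  {χ : Fin 3 → Bool} {missing : ℕ → Option (ZMod n)} {e : ℕ → Config n k}

/-! ### The unmarked robot between `A` and `B` -/

theorem View.shift {β : Bool} {c : Config n k} (h : View χ β c u m) (r : Fin 3) (z : ℤ) :
    View χ β c (Function.update u r (u r + z * n)) m := by
  refine ⟨fun s => ?_, h.mem⟩
  rw [h.pos]
  by_cases hs : s = r
  · subst hs
    simp
  · rw [Function.update_of_ne hs]

/-- A direction, as labelled by a robot with the same orientation or with the other one. -/
def turn (same : Bool) (d : Dir) : Dir := if same then d else d.opp

theorem turn_not (same : Bool) (d : Dir) : turn (!same) d = (turn same d).opp := by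
  cases same <;> simp [turn, Dir.opp_opp]

theorem prep_explore {β : Bool} {r : Fin 3} {l : BitVec k} {d : Dir} {ph τ : ℕ}
    (h : m r = ⟨l, d, .explore ph τ⟩) :
    prep χ β m r = ⟨l, turn (χ r == β) (Mem.phaseDir l ph), .explore ph τ⟩ := by
  rw [prep, h]
  cases χ r == β <;> rfl

theorem afterMove_explore_eq (i : BitVec k) (d : Dir) (x : Bool) (ph τ : ℕ) :
    ∃ ph' τ', (⟨i, d, .explore ph τ⟩ : Mem k).afterMove x = ⟨i, d, .explore ph' τ'⟩ := by
  rw [Mem.afterMove_explore]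
  split
  · exact ⟨_, _, rfl⟩
  · exact ⟨_, _, rfl⟩

/-- The robots `f` and `g` are `A` and `B`, they have explored an arc with `L` edges, and the
unmarked robot `c` is at distances `x` and `y` from them. -/
structure Gap (χ : Fin 3 → Bool) (e : ℕ → Config n k) (t : ℕ) (L : ℕ) : Prop where
  data : ∃ (β : Bool) (u : Fin 3 → ℤ) (m : Fin 3 → Mem k) (f g c : Fin 3) (i j l : BitVec k)
    (d : Dir) (b : Bool) (p q ph τ x y : ℕ), View χ β (e t) u m ∧ Tri f g c ∧
    m f = ⟨i, .left, mark b p⟩ ∧ m g = ⟨j, .right, mark (!b) q⟩ ∧ m c = ⟨l, d, .explore ph τ⟩ ∧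
    u f = u g + L ∧ u c = u f + x ∧ (p + q = L ∨ p + q + 1 = L) ∧
    VisitedArc e t β (u g) (u f) ∧ 1 ≤ x ∧ 1 ≤ y ∧ L + x + y = n

/-- `f` and `g` are separated by at least two edges on the side of `c`, so they use different edges
and the arc grows. The alternatives say whether `c` stays unmarked, becomes `C`, or becomes `C` by
crossing `f` in the very round in which `f` and `g` meet. -/
theorem Gap.step_of_right (hn : 3 ≤ n) (he : IsRun χ missing e) {t : ℕ} {β : Bool} {f g c : Fin 3}
    {i j l : BitVec k} {b : Bool} {p q ph τ x y L : ℕ}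
    (hmv : Moves n u m mv) (hv' : View χ β (e (t + 1)) (move u m mv) (result n u m mv))
    (ht : Tri f g c) (mf : m f = ⟨i, .left, mark b p⟩) (mg : m g = ⟨j, .right, mark (!b) q⟩)
    (mc : m c = ⟨l, .right, .explore ph τ⟩) (uf : u f = u g + L) (uc : u c = u f + x)
    (hpq : p + q = L ∨ p + q + 1 = L) (hvis : VisitedArc e t β (u g) (u f))
    (hx : 1 ≤ x) (hy : 1 ≤ y) (hL : L + x + y = n) :
    (∃ L', Gap χ e (t + 1) L' ∧ L < L') ∨
      (∃ x y s v, Leg χ e (t + 1) x y s v ∧ L < x + y) ∨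
      Finishes e (t + 1) (t + 1 + (n + 2)) := by
  have hf := Bool.toNat_le (mv f)
  have hg := Bool.toNat_le (mv g)
  have hc := Bool.toNat_le (mv c)
  have df : (m f).dir = .left := by rw [mf]
  have dg : (m g).dir = .right := by rw [mg]
  have dc : (m c).dir = .right := by rw [mc]
  have nf : ¬ (m f).Halted := by rw [mf]; simp
  have ng : ¬ (m g).Halted := by rw [mg]; simp
  have nc : ¬ (m c).Halted := by rw [mc]; simp
  have hfg := hmv.one_le nf ng (by
    rw [df, dg, sameEdge_left_right]
    intro h
    rcases dvd_cases h (by omega) (by omega) with h | h | h <;> omega)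
  have hgc := hmv.one_le ng nc (by
    rw [dg, dc, sameEdge_right_right]
    intro h
    rcases dvd_cases h (by omega) (by omega) with h | h | h <;> omega)
  have hfc : x = 1 → (mv f).toNat = (mv c).toNat := by
    intro h
    rw [hmv.same f c nf nc]
    rw [df, dc, sameEdge_left_right, show u f + 1 - u c = 0 by omega]
    exact dvd_zero _
  have hfc1 : 1 < x → 1 ≤ (mv f).toNat + (mv c).toNat := by
    intro h1
    refine hmv.one_le nf nc ?_
    rw [df, dc, sameEdge_left_right]
    intro h
    rcases dvd_cases h (by omega) (by omega) with h | h | h <;> omega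
  have mvf := move_left (u := u) (mv := mv) df
  have mvg := move_right (u := u) (mv := mv) dg
  have mvc := move_right (u := u) (mv := mv) dc
  have xfg : ¬ Cross n u m mv f g := by
    rw [cross_left_right df dg]
    rintro ⟨-, -, h⟩
    rcases dvd_cases h (by omega) (by omega) with h | h | h <;> omega
  have xcg : ¬ Cross n u m mv c g := not_cross_of_dir_eq (by rw [dc, dg])
  have xg : crossed n u m mv g = ⟨j, .right, mark (!b) (q + (mv g).toNat)⟩ := by
    rw [crossed_self (ht.swap.forall_ne (mt Cross.symm xfg) (mt Cross.symm xcg)), mg,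
      Mem.afterMove_mark]
  have hvis' : VisitedArc e (t + 1) β (move u m mv g) (move u m mv f) :=
    hvis.extend hv' rfl rfl (by omega) (by omega)
  obtain ⟨ph', τ', hexp⟩ := afterMove_explore_eq l .right (mv c) ph τ
  by_cases hcross : x = 1 ∧ (mv f).toNat = 1
  · obtain ⟨rfl, hf1⟩ := hcross
    have hc1 := (hfc rfl).symm.trans hf1
    have xfc : Cross n u m mv f c := by
      rw [cross_left_right df dc, show u f + 1 - u c = 0 by omega]
      exact ⟨hf1, hc1, dvd_zero _⟩
    have xf : crossed n u m mv f = ⟨i, .left, mark b (p + 1)⟩ := by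
      rw [crossed_pair ht.rotate.rev xfc nf nc xfg, mf, mc, hexp, Mem.afterMove_mark, hf1,
        Mem.meet_mark_explore]
    have xc : crossed n u m mv c = ⟨l, .right, cproc (!b) (some 0) none none⟩ := by
      rw [crossed_pair ht.rotate.rotate xfc.symm nc nf xcg, mf, mc, hexp, Mem.afterMove_mark,
        Mem.meet_explore_mark]
      rfl
    have yfc : ¬ Node n (move u m mv) f c := by
      intro h
      rcases dvd_cases h (by omega) (by omega) with h | h | h <;> omega
    -- `C` has passed `f` and `f` now meets `g` one node further: the chase begins with `f` directly
    -- behind `C`.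
    by_cases hmeet : y = 1 ∧ (mv g).toNat = 1
    · have yfg : Node n (move u m mv) f g := by
        rw [Node, show move u m mv f - move u m mv g = n by omega]
      have ycg : ¬ Node n (move u m mv) c g := by
        intro h
        rcases dvd_cases h (by omega) (by omega) with h | h | h <;> omega
      have hf' : result n u m mv f = ⟨i, .left, .startTermination (p + q + 3)⟩ := by
        rw [result_pair ht yfg (by simp [xf]) (by simp [xg]) (absurd · yfc), xf, xg,
          Mem.meet_mark_mark, Mem.expire_term _ _ (by omega)]
        congr 2
        omega
      have hg' : result n u m mv g = ⟨j, .right, .startTermination (p + q + 3)⟩ := by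
        have := Mem.meet_mark_mark j i .right .left (!b) (q + (mv g).toNat) (p + 1)
        rw [Bool.not_not] at this
        rw [result_pair ht.swap yfg.symm (by simp [xg]) (by simp [xf]) (absurd ·.symm ycg), xf, xg,
          this, Mem.expire_term _ _ (by omega)]
        congr 2
        omega
      have hc' : result n u m mv c = ⟨l, .right, cproc (!b) (some 0) none none⟩ := by
        rw [result_self (ht.rev.forall_ne (absurd · ycg) (absurd ·.symm yfc)), xc,
          Mem.expire_cproc]
      refine .inr (.inr (Finishes.of_explored (hvis'.exploredBy (by omega) (by omega)) ?_))
      refine (allHaltedBy_of_chase hn he ht.swap (z := n - 1) (w := 1) (i := j) (j := i) (l := l)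
        (T := p + q + 3) hv'.flip (by rw [hg']; rfl) (by rw [hf']; rfl) (by rw [hc']; rfl)
        ?_ ?_ ?_ ?_ ?_ ?_).mono ?_ <;> omega
    · have yfg : ¬ Node n (move u m mv) f g := by
        intro h
        rcases dvd_cases h (by omega) (by omega) with h | h | h <;> omega
      have hf' : result n u m mv f = ⟨i, .left, mark b (p + 1)⟩ := by
        rw [result_self (ht.forall_ne (absurd · yfg) (absurd · yfc)), xf, Mem.expire_mark]
      -- Here `L = 0` and `g` is blocked: after crossing `f`, `C` lands on the node where `g` still
      -- is, and turns back at once with count `0`.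
      by_cases hmeet' : L + (mv g).toNat = 0
      · have ycg : Node n (move u m mv) c g := by
          rw [Node, show move u m mv c - move u m mv g = 0 by omega]
          exact dvd_zero _
        have hc' : result n u m mv c = ⟨l, .left, cproc b (some 0) (some 0) none⟩ := by
          rw [result_pair ht.rev ycg (by simp [xc]) (by simp [xg]) (absurd ·.symm yfc), xc, xg,
            Mem.meet_cproc_mark, agree_none_right, Option.elim_none, Mem.expire_cproc, Bool.not_not]
          rfl
        have hg' : result n u m mv g = ⟨j, .right, mark (!b) (q + (mv g).toNat)⟩ := by
          rw [result_pair ht.rotate ycg.symm (by simp [xg]) (by simp [xc]) (absurd ·.symm yfg), xc,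
            xg, Mem.meet_mark_cproc, agree_none_right, Option.elim_none, Mem.expire_mark]
        refine .inr (.inl ⟨1, 0, some 0, some 0, ⟨⟨β, _, _, f, g, c, i, j, l, b, p + 1,
          q + (mv g).toNat, none, hv', ht, hf', hg', hc', by omega, by omega, by omega, hvis'⟩,
          le_rfl, by omega, ?_, ?_⟩, by omega⟩)
        · rintro _ ⟨⟩
          exact le_rfl
        · rintro _ _ ⟨⟩ ⟨⟩
          omega
      · have ycg : ¬ Node n (move u m mv) c g := by
          intro h
          rcases dvd_cases h (by omega) (by omega) with h | h | h <;> omega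
        have hg' : result n u m mv g = ⟨j, .right, mark (!b) (q + (mv g).toNat)⟩ := by
          rw [result_self (ht.swap.forall_ne (absurd ·.symm yfg) (absurd ·.symm ycg)), xg,
            Mem.expire_mark]
        have hc' : result n u m mv c = ⟨l, .right, cproc (!b) (some 0) none none⟩ := by
          rw [result_self (ht.rev.forall_ne (absurd · ycg) (absurd ·.symm yfc)), xc,
            Mem.expire_cproc]
        -- The crossed edge separates `C` from `f` but is not counted by `C`; this is why `Leg.le`
        -- is only an inequality.
        refine .inr (.inl ⟨L + (mv g).toNat, 1, some 0, none, ⟨⟨!β, _, _, g, f, c, j, i, l, !b,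
          q + (mv g).toNat, p + 1, none, hv'.flip, ht.swap, by rw [hg']; rfl,
          by rw [hf', Bool.not_not]; rfl, by rw [hc']; rfl,
          by omega, by omega, by omega, hvis'.flip⟩, by omega, by omega, ?_, ?_⟩, by omega⟩)
        · rintro _ ⟨⟩
          omega
        · rintro _ _ _ ⟨⟩
  · have xfc : ¬ Cross n u m mv f c := by
      rw [cross_left_right df dc]
      rintro ⟨h1, -, h⟩
      rcases dvd_cases h (by omega) (by omega) with h | h | h <;> omega
    have xf : crossed n u m mv f = ⟨i, .left, mark b (p + (mv f).toNat)⟩ := by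
      rw [crossed_self (ht.forall_ne xfg xfc), mf, Mem.afterMove_mark]
    have xc : crossed n u m mv c = ⟨l, .right, .explore ph' τ'⟩ := by
      rw [crossed_self (ht.rev.forall_ne xcg (mt Cross.symm xfc)), mc, hexp]
    have yfg : ¬ Node n (move u m mv) f g := by
      intro h
      rcases dvd_cases h (by omega) (by omega) with h | h | h <;> omega
    by_cases hmeet : x = (mv f).toNat + (mv c).toNat
    · have yfc : Node n (move u m mv) f c := by
        rw [Node, show move u m mv f - move u m mv c = 0 by omega]
        exact dvd_zero _
      have ycg : ¬ Node n (move u m mv) c g := by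
        intro h
        rcases dvd_cases h (by omega) (by omega) with h | h | h <;> omega
      have hg' : result n u m mv g = ⟨j, .right, mark (!b) (q + (mv g).toNat)⟩ := by
        rw [result_self (ht.swap.forall_ne (absurd ·.symm yfg) (absurd ·.symm ycg)), xg,
          Mem.expire_mark]
      have hf' : result n u m mv f = ⟨i, .left, mark b (p + (mv f).toNat)⟩ := by
        rw [result_pair ht.rotate.rev yfc (by simp [xf]) (by simp [xc]) (absurd · yfg), xf, xc,
          Mem.meet_mark_explore, Mem.expire_mark]
      have hc' : result n u m mv c = ⟨l, .right, cproc (!b) (some 0) none none⟩ := by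
        rw [result_pair ht.rotate.rotate yfc.symm (by simp [xc]) (by simp [xf]) (absurd · ycg), xf,
          xc, Mem.meet_explore_mark, Mem.expire_cproc]
        rfl
      refine .inr (.inl ⟨L + (mv f).toNat + (mv g).toNat, 0, some 0, none, ⟨⟨!β, _, _, g, f, c,
        j, i, l, !b, q + (mv g).toNat, p + (mv f).toNat, none, hv'.flip, ht.swap, by rw [hg']; rfl,
        by rw [hf', Bool.not_not]; rfl, by rw [hc']; rfl,
        by omega, by omega, by omega, hvis'.flip⟩, by omega, by omega, ?_, ?_⟩, by omega⟩)
      · rintro _ ⟨⟩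
        omega
      · rintro _ _ _ ⟨⟩
    · have yfc : ¬ Node n (move u m mv) f c := by
        intro h
        rcases dvd_cases h (by omega) (by omega) with h | h | h <;> omega
      have hf' : result n u m mv f = ⟨i, .left, mark b (p + (mv f).toNat)⟩ := by
        rw [result_self (ht.forall_ne (absurd · yfg) (absurd · yfc)), xf, Mem.expire_mark]
      -- `g` reaches the blocked robot `c`: `y = 1`.
      by_cases hmeet' : y + (mv c).toNat = (mv g).toNat
      · have ycg : Node n (move u m mv) c g := by
          rw [Node, show move u m mv c - move u m mv g = n by omega]
        have hc' : result n u m mv c = ⟨l, .left, cproc b (some 0) none none⟩ := by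
          rw [result_pair ht.rev ycg (by simp [xc]) (by simp [xg]) (absurd ·.symm yfc), xc, xg,
            Mem.meet_explore_mark, Mem.expire_cproc, Bool.not_not]
          rfl
        have hg' : result n u m mv g = ⟨j, .right, mark (!b) (q + (mv g).toNat)⟩ := by
          rw [result_pair ht.rotate ycg.symm (by simp [xg]) (by simp [xc]) (absurd ·.symm yfg), xc,
            xg, Mem.meet_mark_explore, Mem.expire_mark]
        -- `c` is at the node of `g` but its coordinate is one turn ahead; it is lowered by `n` to
        -- put `C` at the rear end of the arc.
        have e1 := Function.update_of_ne ht.ac (move u m mv c + (-1) * n) (move u m mv)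
        have e2 := Function.update_of_ne ht.bc (move u m mv c + (-1) * n) (move u m mv)
        have e3 := Function.update_self c (move u m mv c + (-1) * n) (move u m mv)
        refine .inr (.inl ⟨L + (mv f).toNat + (mv g).toNat, 0, some 0, none, ⟨⟨β, _, _, f, g, c,
          i, j, l, b, p + (mv f).toNat, q + (mv g).toNat, none, hv'.shift c (-1), ht, hf', hg', hc',
          by omega, by omega, by omega, by rwa [e1, e2]⟩, by omega, by omega, ?_, ?_⟩, by omega⟩)
        · rintro _ ⟨⟩
          omega
        · rintro _ _ _ ⟨⟩
      · have ycg : ¬ Node n (move u m mv) c g := by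
          intro h
          rcases dvd_cases h (by omega) (by omega) with h | h | h <;> omega
        have hg' : result n u m mv g = ⟨j, .right, mark (!b) (q + (mv g).toNat)⟩ := by
          rw [result_self (ht.swap.forall_ne (absurd ·.symm yfg) (absurd ·.symm ycg)), xg,
            Mem.expire_mark]
        have hc' : result n u m mv c = ⟨l, .right, .explore ph' τ'⟩ := by
          rw [result_self (ht.rev.forall_ne (absurd · ycg) (absurd ·.symm yfc)), xc,
            Mem.expire_explore]
        exact .inl ⟨L + (mv f).toNat + (mv g).toNat, ⟨β, _, _, f, g, c, i, j, l, .right, b,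
          p + (mv f).toNat, q + (mv g).toNat, ph', τ', x - (mv c).toNat - (mv f).toNat,
          y + (mv c).toNat - (mv g).toNat, hv', ht, hf', hg', hc', by omega, by omega, by omega,
          hvis', by omega, by omega, by omega⟩, by omega⟩

theorem Gap.step (hn : 3 ≤ n) (he : IsRun χ missing e) {t L : ℕ} (h : Gap χ e t L) :
    (∃ L', Gap χ e (t + 1) L' ∧ L < L') ∨
      (∃ x y s v, Leg χ e (t + 1) x y s v ∧ L < x + y) ∨
      Finishes e (t + 1) (t + 1 + (n + 2)) := by
  obtain ⟨β, u, m, f, g, c, i, j, l, d, b, p, q, ph, τ, x, y, hv, ht, mf, mg, mc, uf, uc, hpq,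
    hvis, hx, hy, hL⟩ := h
  have hprep : ∀ {β : Bool} {m : Fin 3 → Mem k} {r : Fin 3} {i : BitVec k} {d : Dir} {b p},
      m r = ⟨i, d, mark b p⟩ → prep χ β m r = ⟨i, d, mark b p⟩ := by
    intro β m r i d b p h
    rw [prep_of_not_explore, h]
    simp [h, Proc.mark_ne_explore]
  cases hd : turn (χ c == β) (Mem.phaseDir l ph) with
  | right =>
    obtain ⟨mv, hmv, hv'⟩ := he.view hv
    exact Gap.step_of_right hn he hmv hv' ht (hprep mf) (hprep mg) (by rw [prep_explore mc, hd])
      uf uc hpq hvis hx hy hL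
  | left =>
    -- After reflection the front robot is `g`; a full turn is added to the coordinate of `c` to
    -- place it beyond `g`.
    have hflip := hv.flip.shift c 1
    obtain ⟨mv, hmv, hv'⟩ := he.view hflip
    have e1 := Function.update_of_ne ht.ac (-u c + 1 * n) (fun r => -u r)
    have e2 := Function.update_of_ne ht.bc (-u c + 1 * n) (fun r => -u r)
    have e3 := Function.update_self c (-u c + 1 * n) (fun r => -u r)
    refine Gap.step_of_right hn he (x := y) (y := x) (L := L) (p := q) (q := p) (i := j) (j := i)
      (l := l) (b := !b) (ph := ph) (τ := τ) hmv hv' ht.swap (hprep (by rw [mg]; rfl))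
      (hprep (by rw [mf, Bool.not_not]; rfl)) ?_ ?_ ?_ ?_ ?_ ?_ ?_ ?_ <;> try omega
    · rw [prep_explore (by rw [mc]; rfl), show (χ c == !β) = !(χ c == β) by
        cases χ c <;> cases β <;> rfl, turn_not, hd]
      rfl
    · rw [e1, e2]
      exact hvis.flip

theorem Gap.not_halted {t L : ℕ} (h : Gap χ e t L) (r : Fin 3) :
    ¬ ((e t).mem r).Halted := by
  obtain ⟨β, u, m, f, g, c, i, j, l, d, b, p, q, ph, τ, x, y, hv, ht, mf, mg, mc, -⟩ := h
  rw [hv.halted_iff]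
  rcases ht.cases r with rfl | rfl | rfl
  · simp [mf]
  · simp [mg]
  · simp [mc]

/-- Growth of the arc before and after the marking of `C` is paid from the same budget `n - 1 - L`,
because the resulting leg satisfies `L < x + y`. -/
theorem Gap.finishes (hn : 3 ≤ n) (he : IsRun χ missing e) {t L : ℕ} (h : Gap χ e t L) :
    Finishes e t (t + (3 * (n - 1) + (n - 1 - L)) + (n + 2)) := by
  have hL : L + 2 ≤ n := by
    obtain ⟨β, u, m, f, g, c, i, j, l, d, b, p, q, ph, τ, x, y, h⟩ := h
    omega
  induction hN : n - L using Nat.strong_induction_on generalizing t L with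
  | _ N ih =>
  refine Finishes.of_succ ?_ h.not_halted
  rcases h.step hn he with ⟨L', h', hlt⟩ | ⟨x, y, s, v, h', hlt⟩ | h'
  · have hL' : L' + 2 ≤ n := by
      obtain ⟨β, u, m, f, g, c, i, j, l, d, b, p, q, ph, τ, x, y, h⟩ := h'
      omega
    exact (ih (n - L') (by omega) h' hL' rfl).mono (by omega)
  · have := legRank_le (n := n) s v h'.len
    have := h'.len
    exact (h'.finishes hn he).mono (by omega)
  · exact h'.mono (by omega)

/-! ### Three robots marked in one meeting -/

/-- All robots are at the same node, where they have just been marked. -/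
def Triple (χ : Fin 3 → Bool) (e : ℕ → Config n k) (t : ℕ) : Prop :=
  ∃ (β : Bool) (u : Fin 3 → ℤ) (m : Fin 3 → Mem k) (f g c : Fin 3) (i j l : BitVec k),
    View χ β (e t) u m ∧ Tri f g c ∧
    m f = ⟨i, .left, mark true 0⟩ ∧ m g = ⟨j, .right, mark false 0⟩ ∧
    m c = ⟨l, .right, cproc false none none none⟩ ∧ u f = u g ∧ u c = u g

/-- `B` and `C` try the same edge, so whether or not it is present they are together after the
round. `C` then turns towards `A`; having no count yet, it records `none`. -/
theorem Triple.step (hn : 3 ≤ n) (he : IsRun χ missing e) {t : ℕ} (h : Triple χ e t) :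
    ∃ x y s v, Leg χ e (t + 1) x y s v := by
  obtain ⟨β, u, m, f, g, c, i, j, l, hv, ht, mf, mg, mc, uf, uc⟩ := h
  obtain ⟨mv, hmv, hv'⟩ := he.view hv
  rw [prep_eq_self ht (by simp [mf, Proc.mark_ne_explore]) (by simp [mg, Proc.mark_ne_explore])
    (by simp [mc, Proc.cproc_ne_explore])] at hmv hv'
  have hf := Bool.toNat_le (mv f)
  have hg := Bool.toNat_le (mv g)
  have df : (m f).dir = .left := by rw [mf]
  have dg : (m g).dir = .right := by rw [mg]
  have dc : (m c).dir = .right := by rw [mc]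
  have nf : ¬ (m f).Halted := by rw [mf]; simp
  have ng : ¬ (m g).Halted := by rw [mg]; simp
  have nc : ¬ (m c).Halted := by rw [mc]; simp
  have hfg := hmv.one_le nf ng (by
    rw [df, dg, sameEdge_left_right]
    intro h
    rcases dvd_cases h (by omega) (by omega) with h | h | h <;> omega)
  have hgc : mv c = mv g := by
    apply hmv.same c g nc ng
    rw [dc, dg, sameEdge_right_right, uc, sub_self]
    exact dvd_zero _
  have mvf := move_left (u := u) (mv := mv) df
  have mvg := move_right (u := u) (mv := mv) dg
  have mvc := move_right (u := u) (mv := mv) dc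
  rw [hgc] at mvc
  have xfg : ¬ Cross n u m mv f g := by
    rw [cross_left_right df dg]
    rintro ⟨-, -, h⟩
    rcases dvd_cases h (by omega) (by omega) with h | h | h <;> omega
  have xfc : ¬ Cross n u m mv f c := by
    rw [cross_left_right df dc]
    rintro ⟨-, -, h⟩
    rcases dvd_cases h (by omega) (by omega) with h | h | h <;> omega
  have xcg : ¬ Cross n u m mv c g := not_cross_of_dir_eq (by rw [dc, dg])
  have xf : crossed n u m mv f = ⟨i, .left, mark true (mv f).toNat⟩ := by
    rw [crossed_self (ht.forall_ne xfg xfc), mf, Mem.afterMove_mark, Nat.zero_add]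
  have xg : crossed n u m mv g = ⟨j, .right, mark false (mv g).toNat⟩ := by
    rw [crossed_self (ht.swap.forall_ne (mt Cross.symm xfg) (mt Cross.symm xcg)), mg,
      Mem.afterMove_mark, Nat.zero_add]
  have xc : crossed n u m mv c = ⟨l, .right, cproc false none none none⟩ := by
    rw [crossed_self (ht.rev.forall_ne xcg (mt Cross.symm xfc)), mc, Mem.afterMove_cproc]
    rfl
  have yfg : ¬ Node n (move u m mv) f g := by
    intro h
    rcases dvd_cases h (by omega) (by omega) with h | h | h <;> omega
  have yfc : ¬ Node n (move u m mv) f c := by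
    intro h
    rcases dvd_cases h (by omega) (by omega) with h | h | h <;> omega
  have ycg : Node n (move u m mv) c g := by
    rw [Node, show move u m mv c - move u m mv g = 0 by omega]
    exact dvd_zero _
  have hf' : result n u m mv f = ⟨i, .left, mark true (mv f).toNat⟩ := by
    rw [result_self (ht.forall_ne (absurd · yfg) (absurd · yfc)), xf, Mem.expire_mark]
  have hg' : result n u m mv g = ⟨j, .right, mark false (mv g).toNat⟩ := by
    rw [result_pair ht.rotate ycg.symm (by simp [xg]) (by simp [xc]) (absurd ·.symm yfg), xc,
      xg, Mem.meet_mark_cproc, agree_none_right, Option.elim_none, Mem.expire_mark]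
  have hc' : result n u m mv c = ⟨l, .left, cproc true (some 0) none none⟩ := by
    rw [result_pair ht.rev ycg (by simp [xc]) (by simp [xg]) (absurd ·.symm yfc), xc, xg,
      Mem.meet_cproc_mark, agree_none_right, Option.elim_none, Mem.expire_cproc]
    rfl
  have hvis : VisitedArc e t β (u g) (u f) := VisitedArc.of_view hv rfl rfl (by omega)
  refine ⟨(mv f).toNat + (mv g).toNat, 0, some 0, none, ⟨β, _, _, f, g, c, i, j, l, true,
    _, _, none, hv', ht, hf', hg', hc', by omega, by omega, by omega,
    hvis.extend hv' rfl rfl (by omega) (by omega)⟩, by omega, by omega, ?_, ?_⟩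
  · rintro _ ⟨⟩
    omega
  · rintro _ _ _ ⟨⟩

theorem Triple.not_halted {t : ℕ} (h : Triple χ e t) (r : Fin 3) : ¬ ((e t).mem r).Halted := by
  obtain ⟨β, u, m, f, g, c, i, j, l, hv, ht, mf, mg, mc, -⟩ := h
  rw [hv.halted_iff]
  rcases ht.cases r with rfl | rfl | rfl
  · simp [mf]
  · simp [mg]
  · simp [mc]

theorem Triple.finishes (hn : 3 ≤ n) (he : IsRun χ missing e) {t : ℕ} (h : Triple χ e t) :
    Finishes e t (t + 4 * (n - 1) + (n + 2)) := by
  obtain ⟨x, y, s, v, h'⟩ := h.step hn he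
  have := legRank_le (n := n) s v h'.len
  have := h'.len
  have := h'.pos
  exact ((h'.finishes hn he).mono (by omega)).of_succ h.not_halted

end DynRing

namespace DynRing

variable {n k : ℕ} {u : Fin 3 → ℤ} {m : Fin 3 → Mem k} {mv : Fin 3 → Bool}
  {χ : Fin 3 → Bool} {missing : ℕ → Option (ZMod n)} {e : ℕ → Config n k}

/-! ### The first meeting -/

theorem dvd_of_eq_left {a x y : ℤ} (h : a ∣ x) (hxy : y = x) : a ∣ y := hxy ▸ h

theorem dvd_of_eq_neg {a x y : ℤ} (h : a ∣ x) (hxy : y = -x) : a ∣ y := hxy ▸ (dvd_neg.2 h)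

theorem Node.neg {r s : Fin 3} : Node n (fun r => -u r) r s ↔ Node n u r s :=
  ⟨fun h => dvd_of_eq_neg h (by ring), fun h => dvd_of_eq_neg h (by ring)⟩

theorem Node.trans {r s q : Fin 3} (h : Node n u r s) (h' : Node n u s q) : Node n u r q :=
  dvd_of_eq_left (dvd_add h h') (by ring)

theorem View.congr {β : Bool} {c : Config n k} {u' : Fin 3 → ℤ} (h : View χ β c u m)
    (hu : ∀ r, (n : ℤ) ∣ u r - u' r) : View χ β c u' m :=
  ⟨fun r => by rw [h.pos, ori_mul_cast_eq_iff]; exact hu r, h.mem⟩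

theorem Tri.exists_lift {a b c : Fin 3} (ht : Tri a b c) (x y z : ℤ) :
    ∃ u : Fin 3 → ℤ, u a = x ∧ u b = y ∧ u c = z :=
  ⟨fun r => if r = a then x else if r = b then y else z, by simp, by simp [ht.ab.symm],
    by simp [ht.ac.symm, ht.bc.symm]⟩

theorem Tri.forall {a b c : Fin 3} (ht : Tri a b c) {P : Fin 3 → Prop} (ha : P a) (hb : P b)
    (hc : P c) (r : Fin 3) : P r := by
  rcases ht.cases r with rfl | rfl | rfl <;> assumption

theorem exists_tri {r s : Fin 3} (hrs : r ≠ s) : ∃ q, Tri r s q := by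
  obtain ⟨q, h1, h2⟩ : ∃ q, r ≠ q ∧ s ≠ q := by
    clear hrs
    decide +revert
  exact ⟨q, hrs, h1, h2⟩

theorem exists_dist (hn : 0 < n) {x y : ℤ} (h : ¬ (n : ℤ) ∣ x - y) :
    ∃ w : ℕ, 1 ≤ w ∧ w + 1 ≤ n ∧ (n : ℤ) ∣ x - (y + w) := by
  have hpos : (0 : ℤ) < n := by omega
  have h1 := Int.emod_nonneg (x - y) hpos.ne'
  have h2 := Int.emod_lt_of_pos (x - y) hpos
  have h3 : (x - y) % n ≠ 0 := fun h' => h (Int.dvd_of_emod_eq_zero h')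
  refine ⟨((x - y) % n).toNat, by omega, by omega, (x - y) / n, ?_⟩
  have := Int.emod_add_mul_ediv (x - y) n
  rw [Int.toNat_of_nonneg h1]
  linarith

/-- The situation after the first meeting. -/
def Marked (χ : Fin 3 → Bool) (e : ℕ → Config n k) (t : ℕ) : Prop :=
  (∃ L, Gap χ e t L) ∨ (∃ x y s v, Leg χ e t x y s v) ∨ Triple χ e t

theorem Marked.finishes (hn : 3 ≤ n) (he : IsRun χ missing e) {t : ℕ} (h : Marked χ e t) :
    Finishes e t (t + 4 * (n - 1) + (n + 2)) := by
  obtain ⟨L, h⟩ | ⟨x, y, s, v, h⟩ | h := h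
  · exact (h.finishes hn he).mono (by omega)
  · have := legRank_le (n := n) s v h.len
    exact (h.finishes hn he).mono (by omega)
  · exact h.finishes hn he

theorem View.proc_eq {β : Bool} {c : Config n k} (h : View χ β c u m) (r : Fin 3) :
    (c.mem r).proc = (m r).proc := by
  rw [← h.mem, Mem.proc_translate]

theorem Marked.exists_mark {t : ℕ} (h : Marked χ e t) :
    ∃ r b p, ((e t).mem r).proc = mark b p := by
  obtain ⟨L, β, u, m, f, g, c, i, j, l, d, b, p, q, ph, τ, x, y, hv, ht, mf, -⟩ |
    ⟨x, y, s, v, ⟨β, u, m, f, g, c, i, j, l, b, p, q, w, hv, ht, mf, -⟩, -⟩ |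
    ⟨β, u, m, f, g, c, i, j, l, hv, ht, mf, -⟩ := h
  all_goals exact ⟨f, _, _, by rw [hv.proc_eq, mf]⟩

/-- `L = 0` after a meeting at a node, `L = 1` after a crossing. The crossed edge belongs to the arc
but is counted by neither robot, which is the origin of the alternative `p + q + 1 = L` in `Gap` and
`Leg`. -/
theorem gap_of_view_left (hn : 3 ≤ n) {t L : ℕ} {β : Bool} {a b c : Fin 3} {i j l : BitVec k}
    {d : Dir} {x : Bool} {ph τ : ℕ} (hL : L ≤ 1) (hv : View χ β (e t) u m) (ht : Tri a b c)
    (ma : m a = ⟨i, .left, mark x 0⟩) (mb : m b = ⟨j, .right, mark (!x) 0⟩)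
    (mc : m c = ⟨l, d, .explore ph τ⟩) (hab : (n : ℤ) ∣ u a - u b - L)
    (hca : ¬ Node n u c a) (hcb : ¬ Node n u c b) : Gap χ e t L := by
  obtain ⟨w, hw1, hw2, hw⟩ := exists_dist (by omega) hca
  obtain ⟨u', ha, hb, hc⟩ := ht.exists_lift (u a) (u a - L) (u a + w)
  have hv' : View χ β (e t) u' m := by
    refine hv.congr (ht.forall ?_ ?_ ?_)
    · simp [ha]
    · exact dvd_of_eq_neg hab (by rw [hb]; ring)
    · rwa [hc]
  have hwL : L + w < n := by
    by_contra h
    refine hcb ?_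
    have : (L : ℤ) + w = n := by omega
    exact dvd_of_eq_left (dvd_add (dvd_add hw hab) (dvd_refl (n : ℤ))) (by linarith)
  exact ⟨β, u', m, a, b, c, i, j, l, d, x, 0, 0, ph, τ, w, n - L - w, hv', ht, ma, mb, mc,
    by omega, by omega, by omega, VisitedArc.of_view hv' rfl rfl (by omega), by omega, by omega,
    by omega⟩

theorem gap_of_view (hn : 3 ≤ n) {t L : ℕ} {β : Bool} {a b c : Fin 3} {i j l : BitVec k}
    {d d' : Dir} {x : Bool} {ph τ : ℕ} (hL : L ≤ 1) (hv : View χ β (e t) u m) (ht : Tri a b c)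
    (ma : m a = ⟨i, d, mark x 0⟩) (mb : m b = ⟨j, d.opp, mark (!x) 0⟩)
    (mc : m c = ⟨l, d', .explore ph τ⟩) (hab : (n : ℤ) ∣ u a - u b - sg d * L)
    (hca : ¬ Node n u c a) (hcb : ¬ Node n u c b) : Gap χ e t L := by
  cases d with
  | left => exact gap_of_view_left hn hL hv ht ma mb mc (by simpa [sg] using hab) hca hcb
  | right =>
    refine gap_of_view_left (x := x) hn hL hv.flip ht (by rw [ma]; rfl) (by rw [mb]; rfl)
      (by rw [mc]; rfl) ?_ ?_ ?_
    · exact dvd_of_eq_neg hab (by simp only [sg]; ring)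
    · rwa [Node.neg]
    · rwa [Node.neg]

/-- This is the case in which the third robot lands on the node of one of two robots that have just
crossed, and is marked `C` in the same round. -/
theorem leg_of_view_left (hn : 3 ≤ n) {t : ℕ} {β : Bool} {a b c : Fin 3} {i j l : BitVec k}
    {x : Bool} (hv : View χ β (e t) u m) (ht : Tri a b c)
    (ma : m a = ⟨i, .left, mark x 0⟩) (mb : m b = ⟨j, .right, mark (!x) 0⟩)
    (mc : m c = ⟨l, .left, cproc x (some 0) none none⟩) (hab : (n : ℤ) ∣ u a - u b - 1)
    (hcb : Node n u c b) : Leg χ e t 1 0 (some 0) none := by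
  obtain ⟨u', ha, hb, hc⟩ := ht.exists_lift (u b + 1) (u b) (u b)
  have hv' : View χ β (e t) u' m := by
    refine hv.congr (ht.forall ?_ ?_ ?_)
    · rw [ha, ← sub_sub]
      exact hab
    · simp [hb]
    · rwa [hc]
  refine ⟨⟨β, u', m, a, b, c, i, j, l, x, 0, 0, none, hv', ht, ma, mb, mc, by omega, by omega,
    by omega, VisitedArc.of_view hv' rfl rfl (by omega)⟩, le_rfl, by omega, ?_, ?_⟩
  · rintro _ ⟨⟩
    omega
  · rintro _ _ _ ⟨⟩

theorem leg_of_view (hn : 3 ≤ n) {t : ℕ} {β : Bool} {a b c : Fin 3} {i j l : BitVec k}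
    {d : Dir} {x : Bool} (hv : View χ β (e t) u m) (ht : Tri a b c)
    (ma : m a = ⟨i, d, mark x 0⟩) (mb : m b = ⟨j, d.opp, mark (!x) 0⟩)
    (mc : m c = ⟨l, d, cproc x (some 0) none none⟩) (hab : (n : ℤ) ∣ u a - u b - sg d)
    (hcb : Node n u c b) : Leg χ e t 1 0 (some 0) none := by
  cases d with
  | left => exact leg_of_view_left hn hv ht ma mb mc hab hcb
  | right =>
    refine leg_of_view_left (x := x) hn hv.flip ht (by rw [ma]; rfl) (by rw [mb]; rfl)
      (by rw [mc]; rfl) ?_ ?_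
    · exact dvd_of_eq_neg hab (by simp only [sg]; ring)
    · rwa [Node.neg]

theorem triple_of_view {t : ℕ} {β : Bool} {a b c : Fin 3} {i j l : BitVec k}
    {d : Dir} (hv : View χ β (e t) u m) (ht : Tri a b c)
    (ma : m a = ⟨i, d, mark true 0⟩) (mb : m b = ⟨j, d.opp, mark false 0⟩)
    (mc : m c = ⟨l, d.opp, cproc false none none none⟩) (hba : Node n u b a)
    (hca : Node n u c a) : Triple χ e t := by
  have hv' : View χ β (e t) (fun _ => u a) m :=
    hv.congr (ht.forall (by simp) hba hca)
  cases d with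
  | left => exact ⟨β, _, m, a, b, c, i, j, l, hv', ht, ma, mb, mc, rfl, rfl⟩
  | right =>
    exact ⟨!β, _, _, a, b, c, i, j, l, hv'.flip, ht, by rw [ma]; rfl, by rw [mb]; rfl,
      by rw [mc]; rfl, rfl, rfl⟩

/-! ### Meetings of unmarked robots -/

namespace Mem

theorem meet_explore_greater {i i' : BitVec k} (d d' : Dir) (p t p' t' : ℕ) (h : i' < i) :
    (⟨i, d, .explore p t⟩ : Mem k).meet [⟨i', d', .explore p' t'⟩] = ⟨i, d, mark true 0⟩ := by
  have : ¬ i < i' := by rw [BitVec.lt_def] at h ⊢; omega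
  simp [meet.eq_def, meetExplore, isTer, isA, isB, isC, mark, this]

theorem meet_explore_less {i i' : BitVec k} (d d' : Dir) (p t p' t' : ℕ) (h : i < i') :
    (⟨i, d, .explore p t⟩ : Mem k).meet [⟨i', d', .explore p' t'⟩] =
      ⟨i, d'.opp, mark false 0⟩ := by
  simp [meet.eq_def, meetExplore, isTer, isA, isB, isC, mark, away, h]

theorem meet_explore_greatest {i i' j' : BitVec k} (d d' e' : Dir) (p t : ℕ) (h : i' < i)
    (h' : j' < i) :
    (⟨i, d, .explore p t⟩ : Mem k).meet [⟨i', d', .explore p t⟩, ⟨j', e', .explore p t⟩] =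
      ⟨i, d, mark true 0⟩ := by
  have h1 : ¬ i < i' := by rw [BitVec.lt_def] at h ⊢; omega
  have h2 : ¬ i < j' := by rw [BitVec.lt_def] at h' ⊢; omega
  simp [meet.eq_def, meetExplore, isTer, isA, isB, isC, mark, h1, h2]

theorem meet_explore_middle {i i' j' : BitVec k} (d d' e' : Dir) (p t : ℕ) (h : i < i')
    (h' : j' < i) :
    (⟨i, d, .explore p t⟩ : Mem k).meet [⟨i', d', .explore p t⟩, ⟨j', e', .explore p t⟩] =
      ⟨i, d'.opp, mark false 0⟩ ∧
    (⟨i, d, .explore p t⟩ : Mem k).meet [⟨j', e', .explore p t⟩, ⟨i', d', .explore p t⟩] =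
      ⟨i, d'.opp, mark false 0⟩ := by
  have h2 : ¬ i < j' := by rw [BitVec.lt_def] at h' ⊢; omega
  simp [meet.eq_def, meetExplore, isTer, isA, isB, isC, mark, away, h, h2]

theorem meet_explore_least {i i' j' : BitVec k} (d d' e' : Dir) (p t : ℕ) (h : i < j')
    (h' : j' < i') :
    (⟨i, d, .explore p t⟩ : Mem k).meet [⟨i', d', .explore p t⟩, ⟨j', e', .explore p t⟩] =
      ⟨i, d'.opp, cproc false none none none⟩ ∧
    (⟨i, d, .explore p t⟩ : Mem k).meet [⟨j', e', .explore p t⟩, ⟨i', d', .explore p t⟩] =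
      ⟨i, d'.opp, cproc false none none none⟩ := by
  have h2 : i < i' := by rw [BitVec.lt_def] at h h' ⊢; omega
  have h3 : ¬ i' < j' := by rw [BitVec.lt_def] at h' ⊢; omega
  simp [meet.eq_def, meetExplore, isTer, isA, isB, isC, cproc, away, h, h', h2, h3]

end Mem

theorem BitVec_lt_or_gt {i j : BitVec k} (h : i ≠ j) : i < j ∨ j < i := by
  rw [BitVec.lt_def, BitVec.lt_def]
  have := mt BitVec.eq_of_toNat_eq h
  omega

theorem exists_sorted {id : Fin 3 → BitVec k} (hid : Function.Injective id) :
    ∃ a b c, Tri a b c ∧ id c < id b ∧ id b < id a := by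
  have h01 := BitVec_lt_or_gt (hid.ne (show (0 : Fin 3) ≠ 1 by decide))
  have h02 := BitVec_lt_or_gt (hid.ne (show (0 : Fin 3) ≠ 2 by decide))
  have h12 := BitVec_lt_or_gt (hid.ne (show (1 : Fin 3) ≠ 2 by decide))
  rcases h01 with h01 | h01 <;> rcases h02 with h02 | h02 <;> rcases h12 with h12 | h12
  · exact ⟨2, 1, 0, by constructor <;> decide, h01, h12⟩
  · exact ⟨1, 2, 0, by constructor <;> decide, h02, h12⟩
  · exact ⟨2, 1, 0, by constructor <;> decide, h01, h12⟩
  · exact ⟨1, 0, 2, by constructor <;> decide, h02, h01⟩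
  · exact ⟨2, 0, 1, by constructor <;> decide, h01, h02⟩
  · exact ⟨1, 2, 0, by constructor <;> decide, h02, h12⟩
  · exact ⟨0, 2, 1, by constructor <;> decide, h12, h02⟩
  · exact ⟨0, 1, 2, by constructor <;> decide, h12, h01⟩

/-- Unmarked robots either are at different nodes, or meet. -/
theorem marked_of_node (hn : 3 ≤ n) {id : Fin 3 → BitVec k} (hid : Function.Injective id)
    {t : ℕ} {β : Bool} {M : Fin 3 → Mem k} {d : Fin 3 → Dir} {ph τ : ℕ} {φ : Mem k → Mem k}
    (hφ : ∀ m : Mem k, (∀ T, m.proc ≠ .startTermination T) → φ m = m)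
    (hM : ∀ r, M r = ⟨id r, d r, .explore ph τ⟩)
    (hv : View χ β (e t) u (fun r => φ (exch (Node n u) M r)))
    (h : ∃ r s, r ≠ s ∧ Node n u r s) : Marked χ e t := by
  -- `φ` stands for `Mem.expire` at the end of a round and for the identity at the start; both fix
  -- every memory that occurs here.
  have hmark : ∀ i d b p, φ (⟨i, d, mark b p⟩ : Mem k) = ⟨i, d, mark b p⟩ :=
    fun i d b p => hφ _ (by cases b <;> simp [mark])
  have hcproc : ∀ i d b s v w, φ (⟨i, d, cproc b s v w⟩ : Mem k) = ⟨i, d, cproc b s v w⟩ :=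
    fun i d b s v w => hφ _ (by cases b <;> simp [cproc])
  have nh : ∀ r, ¬ (M r).Halted := fun r => by simp [hM]
  have hpair : ∃ a b c, Tri a b c ∧ Node n u a b ∧ id b < id a := by
    obtain ⟨r, s, hrs, h⟩ := h
    obtain ⟨q, hq⟩ := exists_tri hrs
    rcases BitVec_lt_or_gt (hid.ne hrs) with hlt | hlt
    · exact ⟨s, r, q, hq.swap, h.symm, hlt⟩
    · exact ⟨r, s, q, hq, h, hlt⟩
  obtain ⟨a, b, c, ht, hab, hlt⟩ := hpair
  -- If the third robot is at this node too, the marks depend on all three identifiers, so the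
  -- robots are renamed in decreasing order.
  by_cases hca : Node n u c a
  · have hall : ∀ r s, Node n u r s := by
      have : ∀ r, Node n u r a := ht.forall (by simp [Node]) hab.symm hca
      exact fun r s => (this r).trans (this s).symm
    clear ht hab hlt hca a b c h
    obtain ⟨a, b, c, ht, hcb, hba⟩ := exists_sorted hid
    have hca : id c < id a := by
      rw [BitVec.lt_def] at hcb hba ⊢
      omega
    refine .inr (.inr (triple_of_view (d := d a) hv ht (i := id a) (j := id b) (l := id c)
      ?_ ?_ ?_ (hall _ _) (hall _ _)))
    · rcases exch_triple ht (hall a b) (hall a c) (nh a) (nh b) (nh c) with h | h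
      · rw [h, hM, hM, hM, Mem.meet_explore_greatest _ _ _ _ _ hba hca, hmark]
      · rw [h, hM, hM, hM, Mem.meet_explore_greatest _ _ _ _ _ hca hba, hmark]
    · rcases exch_triple ht.swap (hall b a) (hall b c) (nh b) (nh a) (nh c) with h | h
      · rw [h, hM, hM, hM, (Mem.meet_explore_middle _ _ _ _ _ hba hcb).1, hmark]
      · rw [h, hM, hM, hM, (Mem.meet_explore_middle _ _ _ _ _ hba hcb).2, hmark]
    · rcases exch_triple ht.rotate.rotate (hall c a) (hall c b) (nh c) (nh a) (nh b) with h | h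
      · rw [h, hM, hM, hM, (Mem.meet_explore_least _ _ _ _ _ hcb hba).1, hcproc]
      · rw [h, hM, hM, hM, (Mem.meet_explore_least _ _ _ _ _ hcb hba).2, hcproc]
  · have hcb : ¬ Node n u c b := fun h => hca (h.trans hab.symm)
    refine .inl ⟨0, gap_of_view hn (d := d a) (d' := d c) (x := true) (i := id a) (j := id b)
      (l := id c) (ph := ph) (τ := τ) (by omega) hv ht ?_ ?_ ?_ (by simpa [Node] using hab) hca hcb⟩
    · rw [exch_pair ht hab (nh a) (nh b) (absurd ·.symm hca), hM, hM,
        Mem.meet_explore_greater _ _ _ _ _ _ hlt, hmark]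
    · rw [exch_pair ht.swap hab.symm (nh b) (nh a) (absurd ·.symm hcb), hM, hM,
        Mem.meet_explore_less _ _ _ _ _ _ hlt, hmark]
      rfl
    · rw [exch_self (ht.rev.forall_ne (absurd · hcb) (absurd · hca)), hM, hφ _ (by simp)]

/-- All robots are unmarked and at different nodes after `t` rounds. -/
structure Exploring (id : Fin 3 → BitVec k) (e : ℕ → Config n k) (t ph τ : ℕ) : Prop where
  id_eq : ∀ r, ((e t).mem r).id = id r
  proc_eq : ∀ r, ((e t).mem r).proc = .explore ph τ
  injective : Function.Injective (e t).pos
  time : 2 ^ ph + τ = t + 1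
  lt : τ < 2 ^ ph

theorem Exploring.not_marked {id : Fin 3 → BitVec k} {t ph τ : ℕ} (h : Exploring id e t ph τ) :
    ¬ Marked χ e t := by
  intro h'
  obtain ⟨r, b, p, hr⟩ := h'.exists_mark
  rw [h.proc_eq] at hr
  exact Proc.mark_ne_explore _ _ _ _ hr.symm

theorem Exploring.not_halted {id : Fin 3 → BitVec k} {t ph τ : ℕ} (h : Exploring id e t ph τ)
    (r : Fin 3) : ¬ ((e t).mem r).Halted := by
  simp [Mem.Halted, h.proc_eq]

theorem Exploring.prep {id : Fin 3 → BitVec k} {t ph τ : ℕ} (h : Exploring id e t ph τ)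
    {β : Bool} (hv : View χ β (e t) u m) (r : Fin 3) :
    prep χ β m r = ⟨id r, turn (χ r == β) (Mem.phaseDir (id r) ph), .explore ph τ⟩ := by
  apply prep_explore (d := (m r).dir)
  rw [← h.id_eq r, ← h.proc_eq r, ← Mem.id_translate (χ r == β), hv.mem, hv.proc_eq]

/-- Because the robots start the round at different nodes, only two of them cross. They end at
adjacent nodes, which differ as `n ≥ 3`, so the third robot joins at most one of them. -/
theorem Exploring.step_of_cross (hn : 3 ≤ n) {id : Fin 3 → BitVec k} {t ph τ : ℕ} {β : Bool}
    {d : Fin 3 → Dir} {a b c : Fin 3} (ht : Tri a b c) (hlt : id b < id a)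
    (hm : ∀ r, m r = ⟨id r, d r, .explore ph τ⟩)
    (hv' : View χ β (e (t + 1)) (move u m mv) (result n u m mv))
    (hinj : ∀ r s, r ≠ s → ¬ Node n u r s) (hab : Cross n u m mv a b) : Marked χ e (t + 1) := by
  have hd : ∀ r, (m r).dir = d r := fun r => by rw [hm]
  have nh : ∀ r, ¬ (m r).Halted := fun r => by simp [hm]
  have ⟨ha, hb, hdb, hdvd⟩ := hab
  rw [hd, hd] at hdb
  rw [hd] at hdvd
  have hmove : ∀ r, mv r = true → move u m mv r = u r + sg (d r) := fun r hr => by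
    rw [move, hr, hd]
    rfl
  obtain ⟨ph', τ', hexp⟩ : ∃ ph' τ', ∀ r, (m r).afterMove (mv r) =
      ⟨id r, d r, .explore ph' τ'⟩ := by
    by_cases hlast : τ + 1 < 2 ^ ph
    · exact ⟨ph, τ + 1, fun r => by rw [hm, Mem.afterMove_explore, if_pos hlast]⟩
    · exact ⟨ph + 1, 0, fun r => by rw [hm, Mem.afterMove_explore, if_neg hlast]⟩
  have xac : ¬ Cross n u m mv a c := by
    rintro ⟨-, -, -, h⟩
    rw [hd] at h
    exact hinj b c ht.bc (dvd_of_eq_left (dvd_sub h hdvd) (by ring))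
  have xbc : ¬ Cross n u m mv b c := by
    rintro ⟨-, -, -, h⟩
    rw [hd, hdb, sg_opp] at h
    exact hinj a c ht.ac (dvd_of_eq_left (dvd_add h hdvd) (by ring))
  have xa : crossed n u m mv a = ⟨id a, d a, mark true 0⟩ := by
    rw [crossed_pair ht hab (nh a) (nh b) xac, hexp, hexp, Mem.meet_explore_greater _ _ _ _ _ _ hlt]
  have xb : crossed n u m mv b = ⟨id b, (d a).opp, mark false 0⟩ := by
    rw [crossed_pair ht.swap hab.symm (nh b) (nh a) xbc, hexp, hexp,
      Mem.meet_explore_less _ _ _ _ _ _ hlt]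
  have xc : crossed n u m mv c = ⟨id c, d c, .explore ph' τ'⟩ := by
    rw [crossed_self (ht.rev.forall_ne (mt Cross.symm xbc) (mt Cross.symm xac)), hexp]
  have hdist : (n : ℤ) ∣ move u m mv a - move u m mv b - sg (d a) :=
    dvd_of_eq_left hdvd (by rw [hmove a ha, hmove b hb, hdb, sg_opp]; ring)
  have yab : ¬ Node n (move u m mv) a b := by
    intro h
    have h1 : (n : ℤ) ∣ sg (d a) := dvd_of_eq_left (dvd_sub h hdist) (by ring)
    have h2 : sg (d a) = 1 ∨ sg (d a) = -1 := by cases d a <;> simp [sg]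
    rcases dvd_cases h1 (by omega) (by omega) with h | h | h <;> omega
  by_cases yca : Node n (move u m mv) c a
  · have ycb : ¬ Node n (move u m mv) c b := fun h => yab (yca.symm.trans h)
    refine .inr (.inl ⟨1, 0, some 0, none, leg_of_view (x := false) (i := id b) (j := id a)
      (l := id c) (d := (d a).opp) hn hv' ht.swap ?_ ?_ ?_ ?_ yca⟩)
    · rw [result_self (ht.swap.forall_ne (absurd ·.symm yab) (absurd ·.symm ycb)), xb,
        Mem.expire_mark]
    · rw [result_pair ht.rotate.rev yca.symm (by simp [xa]) (by simp [xc]) (absurd · yab), xa, xc,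
        Mem.meet_mark_explore, Mem.expire_mark, Dir.opp_opp]
      rfl
    · rw [result_pair ht.rotate.rotate yca (by simp [xc]) (by simp [xa]) (absurd · ycb), xa, xc,
        Mem.meet_explore_mark, Mem.expire_cproc]
      rfl
    · exact dvd_of_eq_neg hdist (by rw [sg_opp]; ring)
  · by_cases ycb : Node n (move u m mv) c b
    · refine .inr (.inl ⟨1, 0, some 0, none, leg_of_view (x := true) (i := id a) (j := id b)
        (l := id c) (d := d a) hn hv' ht ?_ ?_ ?_ hdist ycb⟩)
      · rw [result_self (ht.forall_ne (absurd · yab) (absurd ·.symm yca)), xa, Mem.expire_mark]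
      · rw [result_pair ht.rotate ycb.symm (by simp [xb]) (by simp [xc]) (absurd ·.symm yab), xb,
          xc, Mem.meet_mark_explore, Mem.expire_mark]
        rfl
      · rw [result_pair ht.rev ycb (by simp [xc]) (by simp [xb]) (absurd · yca), xb, xc,
          Mem.meet_explore_mark, Mem.expire_cproc, Dir.opp_opp]
        rfl
    · refine .inl ⟨1, gap_of_view (x := true) (i := id a) (j := id b) (l := id c) (d := d a)
        (d' := d c) (ph := ph') (τ := τ') hn le_rfl hv' ht ?_ ?_ ?_ ?_ yca ycb⟩
      · rw [result_self (ht.forall_ne (absurd · yab) (absurd ·.symm yca)), xa, Mem.expire_mark]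
      · rw [result_self (ht.swap.forall_ne (absurd ·.symm yab) (absurd ·.symm ycb)), xb,
          Mem.expire_mark]
        rfl
      · rw [result_self (ht.rev.forall_ne (absurd · ycb) (absurd · yca)), xc, Mem.expire_explore]
      · simpa using hdist

/-- The absence of crossings is recorded besides the next state: distinct positions before and after
a round do not exclude an exchange of places, and the distance argument needs this. -/
theorem Exploring.step (hn : 3 ≤ n) (he : IsRun χ missing e) {id : Fin 3 → BitVec k}
    (hid : Function.Injective id) {t ph τ : ℕ} (h : Exploring id e t ph τ) {β : Bool}
    (hv : View χ β (e t) u m) :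
    ∃ mv, Moves n u (DynRing.prep χ β m) mv ∧
      View χ β (e (t + 1)) (move u (DynRing.prep χ β m) mv) (result n u (DynRing.prep χ β m) mv) ∧
      ((∀ r s, r ≠ s → ¬ Cross n u (DynRing.prep χ β m) mv r s) ∧
        (∃ ph' τ', Exploring id e (t + 1) ph' τ') ∨ Marked χ e (t + 1)) := by
  obtain ⟨mv, hmv, hv'⟩ := he.view hv
  refine ⟨mv, hmv, hv', ?_⟩
  have hm := h.prep hv
  have hinj : ∀ r s, r ≠ s → ¬ Node n u r s := fun r s hrs hnode =>
    hrs (h.injective ((hv.pos_eq_iff r s).2 hnode))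
  generalize DynRing.prep χ β m = m' at *
  by_cases hcross : ∃ r s, r ≠ s ∧ Cross n u m' mv r s
  · right
    obtain ⟨r, s, hrs, hc⟩ := hcross
    obtain ⟨q, hq⟩ := exists_tri hrs
    rcases BitVec_lt_or_gt (hid.ne hrs) with hlt | hlt
    · exact Exploring.step_of_cross hn hq.swap hlt hm hv' hinj hc.symm
    · exact Exploring.step_of_cross hn hq hlt hm hv' hinj hc
  · push Not at hcross
    obtain ⟨ph', τ', htime, hlt, hexp⟩ : ∃ ph' τ', 2 ^ ph' + τ' = t + 1 + 1 ∧ τ' < 2 ^ ph' ∧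
        ∀ r, (m' r).afterMove (mv r) =
          ⟨id r, turn (χ r == β) (Mem.phaseDir (id r) ph), .explore ph' τ'⟩ := by
      have h1 := h.time
      have h2 := h.lt
      by_cases hlast : τ + 1 < 2 ^ ph
      · exact ⟨ph, τ + 1, by omega, hlast, fun r => by
          rw [hm, Mem.afterMove_explore, if_pos hlast]⟩
      · exact ⟨ph + 1, 0, by rw [pow_succ]; omega, by positivity, fun r => by
          rw [hm, Mem.afterMove_explore, if_neg hlast]⟩
    have hx : crossed n u m' mv = fun r =>
        ⟨id r, turn (χ r == β) (Mem.phaseDir (id r) ph), .explore ph' τ'⟩ := by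
      funext r
      rw [crossed_self fun s hs => hcross r s hs.symm, hexp]
    by_cases hnode : ∃ r s, r ≠ s ∧ Node n (move u m' mv) r s
    · right
      refine marked_of_node hn hid (φ := Mem.expire) ?_ (fun r => congrFun hx r) hv' hnode
      intro m hm
      rw [Mem.expire]
      split
      · rename_i h
        exact absurd h (hm 0)
      · rfl
    · left
      push Not at hnode
      have hres : ∀ r, result n u m' mv r =
          ⟨id r, turn (χ r == β) (Mem.phaseDir (id r) ph), .explore ph' τ'⟩ := by
        intro r
        rw [result_self fun s hs h => absurd h (hnode r s hs.symm), hx, Mem.expire_explore]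
      refine ⟨hcross, ph', τ', fun r => ?_, fun r => ?_, fun r s hrs => ?_, htime, hlt⟩
      · rw [← Mem.id_translate (χ r == β), hv'.mem, hres]
      · rw [hv'.proc_eq, hres]
      · by_contra hne
        exact hnode r s hne ((hv'.pos_eq_iff r s).1 hrs)

end DynRing

/-! ### The time of the first meeting -/

namespace DynRing

variable {n k : ℕ} {u : Fin 3 → ℤ} {m : Fin 3 → Mem k}
  {χ : Fin 3 → Bool} {missing : ℕ → Option (ZMod n)} {e : ℕ → Config n k}

/-- Phase `i` starts after `2 ^ i - 1` rounds, and the intervals from `2 ^ i` to `2 ^ (i + 1)` do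
not overlap. -/
theorem Exploring.phase_eq {id : Fin 3 → BitVec k} {t ph τ i j : ℕ} (h : Exploring id e t ph τ)
    (ht : t + 1 = 2 ^ i + j) (hj : j < 2 ^ i) : ph = i := by
  have h1 := h.time
  have h2 := h.lt
  rcases lt_trichotomy ph i with hlt | heq | hlt
  · have := Nat.pow_le_pow_right (show 0 < 2 by omega) (show ph + 1 ≤ i from hlt)
    rw [pow_succ] at this
    omega
  · exact heq
  · have := Nat.pow_le_pow_right (show 0 < 2 by omega) (show i + 1 ≤ ph from hlt)
    rw [pow_succ] at this
    omega

/-- In a phase where `q` heads for `p` and `r`, which head for `q`, the distances decrease. -/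
theorem exists_view_of_exploring (hn : 3 ≤ n) (he : IsRun χ missing e) {id : Fin 3 → BitVec k}
    (hid : Function.Injective id) {β : Bool} {p q r : Fin 3} (ht : Tri p q r) {i t₀ : ℕ}
    (ht₀ : t₀ + 1 = 2 ^ i) (hi : n ≤ 2 ^ i)
    (hp : turn (χ p == β) (Mem.phaseDir (id p) i) = .left)
    (hq : turn (χ q == β) (Mem.phaseDir (id q) i) = .right)
    (hr : turn (χ r == β) (Mem.phaseDir (id r) i) = .left)
    (hv : View χ β (e t₀) u m) {x y : ℕ} (hx : 1 ≤ x) (hxy : x < y) (hy : y + 1 ≤ n)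
    (up : u p = u q - x) (ur : u r = u q - y) {j : ℕ} (hj : j + 2 ≤ n)
    (hexp : ∀ t ≤ t₀ + j, ∃ ph τ, Exploring id e t ph τ) :
    ∃ (u : Fin 3 → ℤ) (m : Fin 3 → Mem k) (x y : ℕ), View χ β (e (t₀ + j)) u m ∧ 1 ≤ x ∧ x < y ∧
      y + j + 1 ≤ n ∧ u p = u q - x ∧ u r = u q - y := by
  induction j with
  | zero => exact ⟨u, m, x, y, hv, hx, hxy, by omega, up, ur⟩
  | succ j ih =>
  obtain ⟨u, m, x, y, hv, hx, hxy, hy, up, ur⟩ := ih (by omega) fun t ht => hexp t (by omega)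
  obtain ⟨ph, τ, h⟩ := hexp (t₀ + j) (by omega)
  obtain rfl := h.phase_eq (i := i) (j := j) (by omega) (by omega)
  obtain ⟨mv, hmv, hv', hstep⟩ := h.step hn he hid hv
  obtain ⟨ph', τ', h'⟩ := hexp (t₀ + j + 1) (by omega)
  obtain ⟨hcross, -⟩ := hstep.resolve_right h'.not_marked
  have hm := h.prep hv
  generalize prep χ β m = m' at *
  have dp : (m' p).dir = .left := by rw [hm, hp]
  have dq : (m' q).dir = .right := by rw [hm, hq]
  have dr : (m' r).dir = .left := by rw [hm, hr]
  have hbp := Bool.toNat_le (mv p)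
  have hbq := Bool.toNat_le (mv q)
  have hbr := Bool.toNat_le (mv r)
  have mvp := move_left (u := u) (mv := mv) dp
  have mvq := move_right (u := u) (mv := mv) dq
  have mvr := move_left (u := u) (mv := mv) dr
  -- From `1 ≤ x < y < n` it follows that `r` is not adjacent to `q` on this side, so the two use
  -- different edges and `y` drops. The order `x < y` persists since `p` and `r` never share a node.
  have hrq := hmv.one_le (r := r) (s := q) (by simp [hm]) (by simp [hm]) (by
    rw [dr, dq, sameEdge_left_right]
    intro h
    rcases dvd_cases h (by omega) (by omega) with h | h | h <;> omega)
  have hnode : ∀ r s, r ≠ s → move u m' mv r ≠ move u m' mv s := by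
    intro r s hrs heq
    refine hrs (h'.injective ((hv'.pos_eq_iff r s).2 ?_))
    rw [heq, sub_self]
    exact dvd_zero _
  have hpq := hnode p q ht.ab
  have hpr := hnode p r ht.ac
  have hx' : ¬ (x = 1 ∧ (mv p).toNat = 1 ∧ (mv q).toNat = 1) := by
    rintro ⟨h1, h2, h3⟩
    refine hcross p q ht.ab ?_
    rw [cross_left_right dp dq]
    refine ⟨h2, h3, ?_⟩
    rw [show u p + 1 - u q = 0 by omega]
    exact dvd_zero _
  exact ⟨_, _, x - (mv p).toNat - (mv q).toNat, y - (mv r).toNat - (mv q).toNat, hv', by omega,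
    by omega, by omega, by omega, by omega⟩

/-- The larger distance is at most `n - 1`, must stay at least `2` as it exceeds the smaller one,
and drops in each round; `n - 2` rounds are too many. The phase lasts that long by `hi`. -/
theorem exists_not_exploring_of_dir (hn : 3 ≤ n) (he : IsRun χ missing e) {id : Fin 3 → BitVec k}
    (hid : Function.Injective id) {β : Bool} {p q r : Fin 3} (ht : Tri p q r) {i t₀ : ℕ}
    (ht₀ : t₀ + 1 = 2 ^ i) (hi : n ≤ 2 ^ i)
    (hp : turn (χ p == β) (Mem.phaseDir (id p) i) = .left)
    (hq : turn (χ q == β) (Mem.phaseDir (id q) i) = .right)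
    (hr : turn (χ r == β) (Mem.phaseDir (id r) i) = .left) :
    ∃ t ≤ t₀ + (n - 2), ¬ ∃ ph τ, Exploring id e t ph τ := by
  by_contra hcon
  push Not at hcon
  obtain ⟨u, m, hv⟩ := View.exists χ β (e t₀)
  obtain ⟨ph, τ, h⟩ := hcon t₀ (by omega)
  have hinj : ∀ r s, r ≠ s → ¬ Node n u r s := fun r s hrs hnode =>
    hrs (h.injective ((hv.pos_eq_iff r s).2 hnode))
  obtain ⟨x, hx1, hx2, hx⟩ := exists_dist (by omega) (hinj q p ht.ab.symm)
  obtain ⟨y, hy1, hy2, hy⟩ := exists_dist (by omega) (hinj q r ht.bc)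
  obtain ⟨u', up, uq, ur⟩ := ht.exists_lift (u q - x) (u q) (u q - y)
  have hv' : View χ β (e t₀) u' m := by
    refine hv.congr (ht.forall ?_ ?_ ?_)
    · exact dvd_of_eq_neg hx (by rw [up]; ring)
    · simp [uq]
    · exact dvd_of_eq_neg hy (by rw [ur]; ring)
  rw [← uq] at up ur
  rcases lt_trichotomy x y with hlt | rfl | hlt
  · obtain ⟨_, _, x, y, h⟩ := exists_view_of_exploring hn he hid ht ht₀ hi hp hq hr hv' hx1 hlt hy2
      up ur (j := n - 2) (by omega) hcon
    omega
  · refine ht.ac (h.injective ((hv'.pos_eq_iff p r).2 ?_))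
    rw [up, ur, sub_self]
    exact dvd_zero _
  · obtain ⟨_, _, x, y, h⟩ := exists_view_of_exploring hn he hid ht.rev ht₀ hi hr hq hp hv' hy1 hlt
      hx2 ur up (j := n - 2) (by omega) hcon
    omega

theorem turn_ne_of_eq {a : Bool} {d d' : Dir} (h : d ≠ d') : turn a d ≠ turn a d' := by
  cases a <;> cases d <;> cases d' <;> simp_all [turn, Dir.opp]

theorem exists_odd_dir {D : Fin 3 → Dir} {r s : Fin 3} (h : D r ≠ D s) :
    ∃ p q t, Tri p q t ∧ D t = D p ∧ D q = (D p).opp := by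
  have hrs : r ≠ s := fun heq => h (by rw [heq])
  obtain ⟨q, hq⟩ := exists_tri hrs
  by_cases hqr : D q = D r
  · refine ⟨r, s, q, hq, hqr, ?_⟩
    revert h
    cases D r <;> cases D s <;> simp [Dir.opp]
  · refine ⟨s, r, q, hq.swap, ?_, ?_⟩
    · revert h hqr
      cases D r <;> cases D s <;> cases D q <;> simp
    · revert h
      cases D r <;> cases D s <;> simp [Dir.opp]

theorem exists_same_orientation (χ : Fin 3 → Bool) : ∃ r s, r ≠ s ∧ χ r = χ s := by
  by_contra h
  push Not at h
  have := Fintype.card_le_of_injective χ fun r s hrs => by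
    by_contra hne
    exact h r s hne hrs
  simp at this

/-- Two robots of equal orientation differ in some bit `j`. With `i₀` minimal such that `n ≤ 2 ^
i₀`, the `k` phases from `i₀` on read every bit, and `2 ^ (i₀ - 1) < n` bounds the last of them. -/
theorem exists_phase {id : Fin 3 → BitVec k} (hid : Function.Injective id) (hn : 3 ≤ n)
    (χ : Fin 3 → Bool) : ∃ i r s, n ≤ 2 ^ i ∧ 2 ^ i ≤ n * 2 ^ k ∧
      turn (χ r) (Mem.phaseDir (id r) i) ≠ turn (χ s) (Mem.phaseDir (id s) i) := by
  obtain ⟨r, s, hrs, hχ⟩ := exists_same_orientation χ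
  obtain ⟨j, hj, hbit⟩ : ∃ j < k, (id r).getLsbD j ≠ (id s).getLsbD j := by
    by_contra h
    push Not at h
    exact hid.ne hrs (BitVec.eq_of_getLsbD_eq h)
  set i₀ := Nat.clog 2 n with hi₀
  have h1 : n ≤ 2 ^ i₀ := Nat.le_pow_clog (by omega) n
  have h2 : 2 ^ i₀.pred < n := Nat.pow_pred_clog_lt_self (by omega) (by omega)
  have hi₀pos : 1 ≤ i₀ := by
    by_contra h
    rw [show i₀ = 0 by omega] at h1
    omega
  obtain ⟨i, hi1, hi2, hi3⟩ : ∃ i, i₀ ≤ i ∧ i < i₀ + k ∧ i % k = j := by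
    have hlt := Nat.mod_lt i₀ (show 0 < k by omega)
    have hdiv := Nat.mod_add_div i₀ k
    by_cases hcase : i₀ % k ≤ j
    · refine ⟨j + k * (i₀ / k), by omega, by omega, ?_⟩
      rw [Nat.add_mul_mod_self_left, Nat.mod_eq_of_lt hj]
    · refine ⟨j + k * (i₀ / k + 1), by rw [mul_add]; omega, by rw [mul_add]; omega, ?_⟩
      rw [Nat.add_mul_mod_self_left, Nat.mod_eq_of_lt hj]
  refine ⟨i, r, s, h1.trans (Nat.pow_le_pow_right (by omega) hi1), ?_, ?_⟩
  · calc 2 ^ i ≤ 2 ^ (i₀.pred + k) := Nat.pow_le_pow_right (by omega) (by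
          rw [Nat.pred_eq_sub_one]; omega)
      _ = 2 ^ i₀.pred * 2 ^ k := pow_add ..
      _ ≤ n * 2 ^ k := Nat.mul_le_mul_right _ h2.le
  · rw [hχ]
    apply turn_ne_of_eq
    rw [Mem.phaseDir, Mem.phaseDir, hi3]
    revert hbit
    cases (id r).getLsbD j <;> cases (id s).getLsbD j <;> simp

theorem exists_not_exploring (hn : 3 ≤ n) (he : IsRun χ missing e) {id : Fin 3 → BitVec k}
    (hid : Function.Injective id) :
    ∃ t ≤ n * 2 ^ k + n, ¬ ∃ ph τ, Exploring id e t ph τ := by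
  obtain ⟨i, r, s, hi, hik, hrs⟩ := exists_phase hid hn χ
  have hpos : 0 < 2 ^ i := by positivity
  have hD : ∀ r, turn (χ r) (Mem.phaseDir (id r) i) =
      turn (χ r == true) (Mem.phaseDir (id r) i) := fun r => by simp
  have hD' : ∀ r, turn (χ r == false) (Mem.phaseDir (id r) i) =
      (turn (χ r) (Mem.phaseDir (id r) i)).opp := fun r => by
    rw [← turn_not]
    cases χ r <;> rfl
  obtain ⟨p, q, t, ht, h1, h2⟩ :=
    exists_odd_dir (D := fun r => turn (χ r) (Mem.phaseDir (id r) i)) hrs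
  -- The orientation `β` is chosen such that `p` heads for `left`.
  have : ∃ t ≤ 2 ^ i - 1 + (n - 2), ¬ ∃ ph τ, Exploring id e t ph τ := by
    cases hp : turn (χ p) (Mem.phaseDir (id p) i) with
    | left =>
      simp only [hp] at h1 h2
      exact exists_not_exploring_of_dir hn he hid (β := true) ht (by omega) hi
        (by rw [← hD, hp]) (by rw [← hD, h2]; rfl) (by rw [← hD, h1])
    | right =>
      simp only [hp] at h1 h2
      exact exists_not_exploring_of_dir hn he hid (β := false) ht (by omega) hi
        (by rw [hD', hp]; rfl) (by rw [hD', h2]; rfl) (by rw [hD', h1]; rfl)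
  obtain ⟨t, ht, h⟩ := this
  exact ⟨t, by omega, h⟩

/-! ### The whole execution -/

theorem exploring_or_marked_initial (hn : 3 ≤ n) {id : Fin 3 → BitVec k}
    (hid : Function.Injective id) {start : Fin 3 → ZMod n} (h0 : e 0 = initial χ id start) :
    (∃ ph τ, Exploring id e 0 ph τ) ∨ Marked χ e 0 := by
  obtain ⟨u, m, hv⟩ := View.exists χ true (e 0)
  have hpos : ∀ r s, start r = start s ↔ Node n u r s := by
    intro r s
    have := hv.pos_eq_iff r s
    rwa [h0] at this
  set M : Fin 3 → Mem k := fun r => (Mem.init (id r)).translate (χ r == true)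
  have hMr : ∀ r, M r = ⟨id r, (M r).dir, .explore 0 0⟩ := by
    intro r
    have h1 : (M r).id = id r := Mem.id_translate _ _
    have h2 : (M r).proc = .explore 0 0 := Mem.proc_translate _ _
    rw [← h1, ← h2]
  have hv' : View χ true (e 0) u (fun r => (fun m => m) (exch (Node n u) M r)) := by
    refine ⟨hv.pos, fun r => ?_⟩
    rw [h0]
    exact translate_exchange χ true _ _ hpos _ r
  by_cases hnode : ∃ r s, r ≠ s ∧ Node n u r s
  · exact .inr (marked_of_node hn hid (fun _ _ => rfl) hMr hv' hnode)
  · push Not at hnode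
    have hres : ∀ r, exch (Node n u) M r = ⟨id r, (M r).dir, .explore 0 0⟩ := by
      intro r
      rw [exch_self fun s hs h => absurd h (hnode r s hs.symm), ← hMr]
    refine .inl ⟨0, 0, fun r => ?_, fun r => ?_, fun r s hrs => ?_, rfl, by simp⟩
    · rw [← Mem.id_translate (χ r == true), hv'.mem, hres]
    · rw [hv'.proc_eq, hres]
    · by_contra hne
      exact hnode r s hne ((hv'.pos_eq_iff r s).1 hrs)

theorem finishes_run (hn : 3 ≤ n) (he : IsRun χ missing e) {id : Fin 3 → BitVec k}
    (hid : Function.Injective id) {start : Fin 3 → ZMod n} (h0 : e 0 = initial χ id start) :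
    Finishes e 0 (7 * n + n * 2 ^ k) := by
  classical
  obtain ⟨T, hT, hnot⟩ := exists_not_exploring hn he hid
  have hex : ∃ t, ¬ ∃ ph τ, Exploring id e t ph τ := ⟨T, hnot⟩
  set t := Nat.find hex with htdef
  have htT : t ≤ T := Nat.find_min' hex hnot
  have hbefore : ∀ s < t, ∃ ph τ, Exploring id e s ph τ := fun s hs =>
    not_not.1 (Nat.find_min hex hs)
  have hat : ¬ ∃ ph τ, Exploring id e t ph τ := Nat.find_spec hex
  clear_value t
  have hmarked : Marked χ e t := by
    rcases t with _ | s
    · exact (exploring_or_marked_initial hn hid h0).resolve_left hat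
    · obtain ⟨ph, τ, h⟩ := hbefore s (by omega)
      obtain ⟨u, m, hv⟩ := View.exists χ true (e s)
      obtain ⟨mv, -, -, h'⟩ := h.step hn he hid hv
      exact h'.resolve_left fun h' => hat h'.2
  -- The sum `(n * 2 ^ k + n) + 4 * (n - 1) + (n + 2)` leaves some slack.
  have hfin : Finishes e t (7 * n + n * 2 ^ k) := (hmarked.finishes hn he).mono (by omega)
  -- Before the first meeting no robot has terminated, so safety extends back to time `0`.
  have hback : ∀ j ≤ t, Finishes e (t - j) (7 * n + n * 2 ^ k) := by
    intro j hj
    induction j with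
    | zero => exact hfin
    | succ j ih =>
      obtain ⟨ph, τ, h⟩ := hbefore (t - (j + 1)) (by omega)
      refine Finishes.of_succ ?_ h.not_halted
      rw [show t - (j + 1) + 1 = t - j by omega]
      exact ih (by omega)
  simpa using hback t le_rfl

end DynRing

theorem mainTheorem1 (n k : ℕ) (hn : 3 ≤ n)
    (id : Fin 3 → BitVec k) (hid : Function.Injective id)
    (χ : Fin 3 → Bool) (start : Fin 3 → ZMod n) (missing : ℕ → Option (ZMod n)) :
    DynRing.ExploresWithExplicitTermination (DynRing.run χ id start missing)
      (7 * n + n * 2 ^ k) := by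
  have he : DynRing.IsRun χ missing (DynRing.run χ id start missing) := fun _ => rfl
  obtain ⟨hsafe, t, ht, hall⟩ := DynRing.finishes_run hn he hid (start := start) rfl
  exact ⟨fun t r => hsafe t (Nat.zero_le t) r, t, ht, hsafe t (Nat.zero_le t) 0 (hall 0),
    fun t' ht' r => he.halted_of_le ht' (hall r)⟩
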